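/- Let $G=(V,E)$ be a connected graph with $n$ vertices and $m$ edges, let $d(v)$ be the degree of $v$, and let $P(v,u)=\mathbf 1_{\{v,u\}\in E}/d(v)$ be the transition matrix of the simple random walk on $G$. Let $\pi_v=d(v)/2m$, $\pi_{\min}=\min_{v\in V}\pi_v$, and let $\lambda=\max\{|\lambda_2|,|\lambda_n|\}$, where $1=\lambda_1\ge\lambda_2\ge\dots\ge\lambda_n$ are the eigenvalues of $P$ with multiplicity. In discrete incremental voting (asynchronous vertex process) with opinions from $[k]=\{1,\dots,k\}$, $k\ge 1$, the vertices start with arbitrary opinions $X_v(0)\in[k]$. At each step, independently of the past, a vertex $v$ is chosen uniformly at random, and then a neighbour $w$ of $v$ is chosen uniformly at random; the opinion of $v$ increases by $1$ if $X_v<X_w$, decreases by $1$ if $X_v>X_w$, and does not change if $X_v=X_w$. All other opinions are unchanged. Let $\tau$ be the first time $t\ge 0$ at which at most two opinions are present and these lie in $\{i,i+1\}$ for some integer $i$. Consider a sequence of such graphs $G$ with $n\to\infty$, with $k$ depending on the graph, such that $$\lambda k=o(1),\qquad k=o(n/\log n),\qquad \pi_{\min}=\Theta(1/n).$$ Then,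 uniformly over all initial opinions in $[k]^V$: 1. there is a deterministic $T=o(n^2)$ such that $\tau\le T$ with probability $1-o(1)$, that is, with high probability only two consecutive opinions $i,i+1$ remain within $T$ steps; 2. $\mathbf E[\tau]=O\left(kn\log n+n^{5/3}\log n+\lambda k n^2+\sqrt{\lambda}\,n^2\right)$. -/

import Mathlib

open Filter MeasureTheory Asymptotics

namespace IncrementalVoting

/-- Transition matrix of the simple random walk on `G`: `P(v,u) = 1_{v ~ u} / d(v)`. -/
noncomputable def walkMatrix {V : Type*} [Fintype V] (G : SimpleGraph V) [DecidableRel G.Adj] :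
    Matrix V V ℝ :=
  Matrix.of fun v u => if G.Adj v u then 1 / (G.degree v : ℝ) else 0

/-- Stationary distribution `π_v = d(v) / (2m)`. -/
noncomputable def stationary {V : Type*} [Fintype V] (G : SimpleGraph V) [DecidableRel G.Adj]
    (v : V) : ℝ :=
  (G.degree v : ℝ) / (2 * (G.edgeFinset.card : ℝ))

/-- `π_min = min_v π_v` (on a finite nonempty vertex set the infimum is a minimum). -/
noncomputable def stationaryMin {V : Type*} [Fintype V] (G : SimpleGraph V)
    [DecidableRel G.Adj] : ℝ :=
  ⨅ v : V, stationary G v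

/-- The second largest absolute value of an eigenvalue of `P`: with
`1 = λ₁ ≥ λ₂ ≥ ... ≥ λₙ` the eigenvalues of `P` listed with multiplicity (the roots of its
characteristic polynomial, all of them real as `P` is reversible), one copy of `λ₁ = 1` is removed
and the largest absolute value of the remaining ones is taken. -/
noncomputable def secondEigenvalue {V : Type*} [Fintype V] [DecidableEq V] (G : SimpleGraph V)
    [DecidableRel G.Adj] : ℝ :=
  (((((walkMatrix G).charpoly.roots.erase 1).map fun μ : ℝ => ‖μ‖₊).sup : NNReal) : ℝ)

/-- Uniform choice of a neighbour of `v`. (At an isolated vertex, which a connected graph on at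
least two vertices does not have, `v` is returned.) -/
noncomputable def neighbourLaw {V : Type*} [Fintype V] (G : SimpleGraph V) [DecidableRel G.Adj]
    (v : V) : PMF V :=
  if h : (G.neighborFinset v).Nonempty then PMF.uniformOfFinset (G.neighborFinset v) h
  else PMF.pure v

/-- One choice `(v, w)` ("`v` chooses `w`") of the asynchronous vertex process: a uniform vertex
`v`, then a uniform neighbour `w` of `v`. -/
noncomputable def choiceLaw {V : Type*} [Fintype V] [Nonempty V] (G : SimpleGraph V)
    [DecidableRel G.Adj] : PMF (V × V) :=
  (PMF.uniformOfFintype V).bind fun v => (neighbourLaw G v).map fun w => (v, w)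

/-- The law of the sequence of independent choices made at the steps `0, 1, 2, ...`. -/
noncomputable def choicesLaw {V : Type*} [Fintype V] [Nonempty V] [MeasurableSpace V]
    (G : SimpleGraph V) [DecidableRel G.Adj] : Measure (ℕ → V × V) :=
  Measure.infinitePi fun _ : ℕ => (choiceLaw G).toMeasure

/-- The update when `c.1` chooses `c.2`: the opinion of `c.1` moves by one towards that of `c.2`,
all other opinions are unchanged. -/
def update {V : Type*} [DecidableEq V] (X : V → ℤ) (c : V × V) : V → ℤ :=
  Function.update X c.1
    (if X c.1 < X c.2 then X c.1 + 1 else if X c.2 < X c.1 then X c.1 - 1 else X c.1)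

/-- The opinions `X(t)` at time `t`, started from `x` and driven by the choices `ω`. -/
def opinions {V : Type*} [DecidableEq V] (x : V → ℤ) (ω : ℕ → V × V) : ℕ → V → ℤ
  | 0 => x
  | t + 1 => update (opinions x ω t) (ω t)

/-- At most two opinions are present, and they are consecutive. -/
def TwoConsecutive {V : Type*} (X : V → ℤ) : Prop :=
  ∃ i : ℤ, ∀ v, X v = i ∨ X v = i + 1

/-- The first time at which only two consecutive opinions remain (`⊤` if there is none). -/
noncomputable def reductionTime {V : Type*} [DecidableEq V] (x : V → ℤ) (ω : ℕ → V × V) : ℕ∞ :=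
  ⨅ (t : ℕ) (_ : TwoConsecutive (opinions x ω t)), (t : ℕ∞)

end IncrementalVoting

open Filter MeasureTheory Asymptotics

/-! The proof is a Lyapunov argument. Let `s` and `l` be the extreme opinions, `A` and `B` their
supporters, `a` and `b` the stationary masses of these sets, and follow `z = √(ab)`. An opinion
never leaves the interval from `s` to `l`, so the range `l - s` never grows, and the extreme
opinions disappear one by one.

One step changes `a` by the stationary weight of the vertex that moves. By reversibility the flow
into `A` from the next opinion cancels the flow back, so the first-order drift of `√a` comes only
from vertices of `A` that see an opinion at distance two or more. Concavity of the square root adds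
a second-order gain of relative size `π_min / a`. The expander mixing lemma `abs_flow_sub_le` turns
these flows into masses. With `λ ≤ 1/2`, the mean of `z` falls per step by at least (i)
`π_min/(16n)` always, from the fluctuations; (ii) `z/(8n)` if `l - s ≥ 3` and `z ≥ 4λ`; (iii)
`z²/(2n)` if `l - s = 2` and `z ≥ 2λ`.

A concave function of `z`, logarithmic above a threshold `ζ` and with an extra linear part below it,
then loses at least one per step in mean (`stepMean_barrier_le`). Stacking one such barrier per
value of the range gives a single potential, whose maximum bounds `E τ` by
`lintegral_reductionTime_le`. With thresholds `4λ + 1/n` for ranges at least three and `2λ + 1/√n`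
for range two, a range of at least three costs `O(n log n + λn²)` and range two costs `O(n^(3/2) log
n + λn²)`. The bound in probability follows by Markov's inequality, because the time scale is
`o(n²)`. -/

namespace IncrementalVoting

/-! ### Shifting a sequence of independent choices. -/

/-- Prepend a value to a sequence. -/
def consSeq {α : Type*} (p : α × (ℕ → α)) : ℕ → α
  | 0 => p.1
  | t + 1 => p.2 t

theorem measurable_consSeq {α : Type*} [MeasurableSpace α] :
    Measurable (consSeq : α × (ℕ → α) → ℕ → α) := by
  refine measurable_pi_lambda _ fun t => ?_
  cases t with
  | zero => exact measurable_fst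
  | succ t => exact (measurable_pi_apply t).comp measurable_snd

/-- A sequence of i.i.d. variables is an independent variable followed by such a sequence. -/
theorem map_consSeq_prod_infinitePi {α : Type*} [MeasurableSpace α] (μ : Measure α)
    [IsProbabilityMeasure μ] :
    (μ.prod (Measure.infinitePi fun _ : ℕ => μ)).map consSeq
      = Measure.infinitePi fun _ : ℕ => μ := by
  classical
  refine Measure.eq_infinitePi _ fun s t ht => ?_
  obtain ⟨N, hN⟩ : ∃ N, s ⊆ Finset.range (N + 1) := by
    obtain ⟨N, hN⟩ := s.exists_nat_subset_range
    exact ⟨N, hN.trans (Finset.range_mono (Nat.le_succ N))⟩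
  -- Padding with `Set.univ` turns the finite cylinder into a box over the initial segment `0, ...,
  -- N`, from which coordinate `0` splits off.
  set t' : ℕ → Set α := fun i => if i ∈ s then t i else Set.univ with ht'
  have htm : ∀ i, MeasurableSet (t' i) := by
    intro i
    by_cases hi : i ∈ s <;> simp [t', hi, ht i]
  have hpre : consSeq ⁻¹' (Set.pi (↑s) t)
      = t' 0 ×ˢ Set.pi (↑(Finset.range N)) (fun i => t' (i + 1)) := by
    ext ⟨c, ω⟩
    simp only [Set.mem_preimage, Set.mem_pi, Finset.mem_coe, Set.mem_prod, Finset.mem_range]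
    constructor
    · intro h
      refine ⟨?_, fun i _ => ?_⟩
      · by_cases h0 : 0 ∈ s
        · simpa [t', h0] using! h 0 h0
        · simp [t', h0]
      · by_cases h0 : i + 1 ∈ s
        · simpa [t', h0] using! h (i + 1) h0
        · simp [t', h0]
    · rintro ⟨h0, h⟩ i hi
      cases i with
      | zero => simpa [t', hi] using! h0
      | succ i =>
        have hlt : i < N := by simpa using hN hi
        simpa [t', hi] using! h i hlt
  rw [Measure.map_apply measurable_consSeq
    (MeasurableSet.pi s.countable_toSet fun i _ => ht i), hpre, Measure.prod_prod,
    Measure.infinitePi_pi _ (fun i _ => htm (i + 1)), mul_comm,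
    ← Finset.prod_range_succ' (fun i => μ (t' i)) N]
  refine (Finset.prod_subset hN fun i _ hi => ?_).symm.trans (Finset.prod_congr rfl fun i hi => ?_)
  · simp [t', hi]
  · simp [t', hi]

/-! ### Explicit probabilities of a single choice. -/

section Choice

variable {V : Type*} [Fintype V] (G : SimpleGraph V) [DecidableRel G.Adj]

theorem walkMatrix_nonneg (v w : V) : 0 ≤ walkMatrix G v w := by
  simp only [walkMatrix, Matrix.of_apply]
  split_ifs <;> positivity

theorem sum_walkMatrix_row {v : V} (hv : 0 < G.degree v) : ∑ w, walkMatrix G v w = 1 := by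
  simp only [walkMatrix, Matrix.of_apply]
  rw [← Finset.sum_filter, Finset.sum_const, ← SimpleGraph.neighborFinset_eq_filter,
    SimpleGraph.card_neighborFinset_eq_degree, nsmul_eq_mul]
  field_simp

theorem sum_walkMatrix_div_card [Nonempty V] (hdeg : ∀ v, 0 < G.degree v) :
    ∑ v, ∑ w, 1 / (Fintype.card V : ℝ) * walkMatrix G v w = 1 := by
  simp_rw [← Finset.mul_sum, sum_walkMatrix_row G (hdeg _)]
  simp

theorem neighbourLaw_apply {v : V} (hv : 0 < G.degree v) (w : V) :
    neighbourLaw G v w = ENNReal.ofReal (walkMatrix G v w) := by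
  have hne : (G.neighborFinset v).Nonempty := by
    rwa [← Finset.card_pos, SimpleGraph.card_neighborFinset_eq_degree]
  rw [neighbourLaw, dif_pos hne, PMF.uniformOfFinset_apply]
  simp only [SimpleGraph.mem_neighborFinset, SimpleGraph.card_neighborFinset_eq_degree,
    walkMatrix, Matrix.of_apply]
  split_ifs
  · rw [one_div, ENNReal.ofReal_inv_of_pos (by positivity), ENNReal.ofReal_natCast]
  · simp

theorem choiceLaw_apply [Nonempty V] {v : V} (hv : 0 < G.degree v) (w : V) :
    choiceLaw G (v, w) = ENNReal.ofReal (1 / (Fintype.card V : ℝ) * walkMatrix G v w) := by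
  rw [choiceLaw, PMF.bind_apply, tsum_eq_single v]
  · rw [PMF.map_apply, tsum_eq_single w]
    · rw [ENNReal.ofReal_mul (by positivity), if_pos rfl, neighbourLaw_apply G hv,
        PMF.uniformOfFintype_apply, one_div, ENNReal.ofReal_inv_of_pos
          (by exact_mod_cast Fintype.card_pos), ENNReal.ofReal_natCast]
    · intro w' hw'
      rw [if_neg]
      simpa [Prod.ext_iff] using hw'.symm
  · intro v' hv'
    rw [PMF.map_apply]
    simp [Prod.ext_iff, hv'.symm]

end Choice

/-! ### The reduction time and its first-step recursion. -/

section HittingTime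

variable {V : Type*} [DecidableEq V]

theorem opinions_consSeq (x : V → ℤ) (c : V × V) (ω : ℕ → V × V) (t : ℕ) :
    opinions x (consSeq (c, ω)) (t + 1) = opinions (update x c) ω t := by
  induction t with
  | zero => rfl
  | succ t ih => rw [opinions, ih]; rfl

theorem reductionTime_eq_zero {x : V → ℤ} (hx : TwoConsecutive x) (ω : ℕ → V × V) :
    reductionTime x ω = 0 := by
  refine le_antisymm ?_ bot_le
  exact (iInf₂_le (0 : ℕ) hx).trans (by simp)

/-- Only an inequality, since `x` itself may already be reduced. -/
theorem reductionTime_consSeq_le (x : V → ℤ) (c : V × V) (ω : ℕ → V × V) :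
    reductionTime x (consSeq (c, ω)) ≤ reductionTime (update x c) ω + 1 := by
  by_cases h : ∃ t, TwoConsecutive (opinions (update x c) ω t)
  · obtain ⟨t, ht, heq⟩ : ∃ t, TwoConsecutive (opinions (update x c) ω t) ∧
        reductionTime (update x c) ω = (t : ℕ∞) := by
      classical
      refine ⟨Nat.find h, Nat.find_spec h,
        le_antisymm (iInf₂_le (Nat.find h) (Nat.find_spec h)) ?_⟩
      exact le_iInf₂ fun t ht => by exact_mod_cast Nat.find_min' h ht
    rw [heq]
    refine (iInf₂_le (t + 1) ?_).trans (by simp)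
    rwa [opinions_consSeq]
  · have : reductionTime (update x c) ω = ⊤ := by
      simp only [not_exists] at h
      simp [reductionTime, h]
    simp [this]

variable [Finite V] [MeasurableSpace V] [DiscreteMeasurableSpace V]

theorem measurable_opinions (x : V → ℤ) (t : ℕ) :
    Measurable fun ω : ℕ → V × V => opinions x ω t := by
  induction t with
  | zero => exact measurable_const
  | succ t ih =>
    have : Measurable fun p : (V → ℤ) × (V × V) => update p.1 p.2 := measurable_of_countable _
    exact this.comp (ih.prodMk (measurable_pi_apply t))

theorem measurable_reductionTime (x : V → ℤ) :
    Measurable fun ω : ℕ → V × V => (reductionTime x ω : ENNReal) := by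
  simp only [reductionTime, ENat.toENNReal_iInf]
  refine Measurable.iInf fun t => ?_
  have hm : Measurable fun X : V → ℤ => ⨅ _ : TwoConsecutive X, ((t : ℕ∞) : ENNReal) :=
    measurable_of_countable _
  exact hm.comp (measurable_opinions x t)

end HittingTime

instance {V : Type*} [Fintype V] [Nonempty V] [MeasurableSpace V] (G : SimpleGraph V)
    [DecidableRel G.Adj] : IsProbabilityMeasure (choicesLaw G) := by
  unfold choicesLaw
  infer_instance

/-- **Drift criterion.** A nonnegative function of the opinions that decreases in mean by at least
one at every step before the reduction time bounds the expected reduction time. -/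
theorem lintegral_reductionTime_le {V : Type*} [Fintype V] [DecidableEq V] [Nonempty V]
    [MeasurableSpace V] [DiscreteMeasurableSpace V] (G : SimpleGraph V) [DecidableRel G.Adj]
    (hdeg : ∀ v, 0 < G.degree v) (Φ : (V → ℤ) → ℝ) (hΦ : ∀ X, 0 ≤ Φ X)
    (hstep : ∀ X, ¬ TwoConsecutive X →
      1 + ∑ v, ∑ w, 1 / (Fintype.card V : ℝ) * walkMatrix G v w * Φ (update X (v, w)) ≤ Φ X)
    (x : V → ℤ) :
    ∫⁻ ω, (reductionTime x ω : ENNReal) ∂(choicesLaw G) ≤ ENNReal.ofReal (Φ x) := by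
  have hτ : ∀ x : V → ℤ, Measurable fun ω : ℕ → V × V => (reductionTime x ω : ENNReal) :=
    measurable_reductionTime
  have hτT : ∀ (T : ℕ) (x : V → ℤ),
      Measurable fun ω : ℕ → V × V => min (reductionTime x ω : ENNReal) T :=
    fun T x => (hτ x).min measurable_const
  -- Truncation at `T` permits induction on `T` by conditioning on the first choice; monotone
  -- convergence removes it at the end.
  have key : ∀ (T : ℕ) (x : V → ℤ),
      ∫⁻ ω, min (reductionTime x ω : ENNReal) T ∂(choicesLaw G) ≤ ENNReal.ofReal (Φ x) := by
    intro T
    induction T with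
    | zero => intro x; simp
    | succ T ih =>
      intro x
      by_cases hx : TwoConsecutive x
      · simp [reductionTime_eq_zero hx]
      have hle : ∀ c : V × V, ∫⁻ ω, min (reductionTime x (consSeq (c, ω)) : ENNReal)
          ((T + 1 : ℕ) : ENNReal) ∂(choicesLaw G) ≤ 1 + ENNReal.ofReal (Φ (update x c)) := by
        intro c
        calc _ ≤ ∫⁻ ω, (1 + min (reductionTime (update x c) ω : ENNReal) T) ∂(choicesLaw G) := by
              refine lintegral_mono fun ω => ?_
              have h := ENat.toENNReal_mono (reductionTime_consSeq_le x c ω)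
              rw [ENat.toENNReal_add, ENat.toENNReal_one] at h
              rw [add_comm 1 (min _ _), ← min_add_add_right, Nat.cast_add, Nat.cast_one]
              exact min_le_min_right _ h
          _ = 1 + ∫⁻ ω, min (reductionTime (update x c) ω : ENNReal) T ∂(choicesLaw G) := by
              rw [lintegral_add_left measurable_const, lintegral_const]
              simp [choicesLaw]
          _ ≤ _ := by gcongr; exact ih _
      have hsplit : choicesLaw G = ((choiceLaw G).toMeasure.prod (choicesLaw G)).map consSeq :=
        (map_consSeq_prod_infinitePi _).symm
      have hm : Measurable fun p : (V × V) × (ℕ → V × V) =>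
          min (reductionTime x (consSeq p) : ENNReal) ((T + 1 : ℕ) : ENNReal) :=
        (hτT (T + 1) x).comp measurable_consSeq
      rw [hsplit, lintegral_map (hτT _ _) measurable_consSeq,
        lintegral_prod _ hm.aemeasurable, lintegral_fintype]
      calc _ ≤ ∑ c : V × V, ENNReal.ofReal ((1 + Φ (update x c)) *
              (1 / (Fintype.card V : ℝ) * walkMatrix G c.1 c.2)) := by
            refine Finset.sum_le_sum fun c _ => ?_
            obtain ⟨v, w⟩ := c
            have h0 : 0 ≤ 1 + Φ (update x (v, w)) := add_nonneg zero_le_one (hΦ _)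
            rw [PMF.toMeasure_apply_singleton _ _ (measurableSet_singleton _),
              choiceLaw_apply G (hdeg v) w, ENNReal.ofReal_mul h0,
              ENNReal.ofReal_add zero_le_one (hΦ _), ENNReal.ofReal_one]
            exact mul_le_mul_left (hle (v, w)) _
        _ ≤ _ := by
            rw [← ENNReal.ofReal_sum_of_nonneg]
            · refine ENNReal.ofReal_le_ofReal (le_trans (le_of_eq ?_) (hstep x hx))
              rw [Fintype.sum_prod_type]
              conv_rhs => arg 1; rw [← sum_walkMatrix_div_card G hdeg]
              simp_rw [← Finset.sum_add_distrib]
              exact Finset.sum_congr rfl fun v _ => Finset.sum_congr rfl fun w _ => by ring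
            · intro c _
              have := hΦ (update x c)
              have := walkMatrix_nonneg G c.1 c.2
              positivity
  have hsup : ∀ ω : ℕ → V × V, (reductionTime x ω : ENNReal)
      = ⨆ T : ℕ, min (reductionTime x ω : ENNReal) T := by
    intro ω
    refine le_antisymm ?_ (iSup_le fun T => min_le_left _ _)
    rw [← inf_iSup_eq, ENNReal.iSup_natCast]
    simp
  rw [lintegral_congr hsup]
  rw [lintegral_iSup (fun T => hτT T x)]
  · exact iSup_le fun T => key T x
  · intro S T hST ω
    exact min_le_min_left _ (by exact_mod_cast hST)

/-! ### Spectral bound for a symmetric matrix off a fixed vector. -/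

section Spectral

open Matrix

variable {V : Type*} [Fintype V] [DecidableEq V]

/-- Parseval's identity in the eigenbasis of a symmetric matrix. -/
theorem dotProduct_eq_sum_eigenvectorBasis {N : Matrix V V ℝ} (hN : N.IsHermitian) (f g : V → ℝ) :
    f ⬝ᵥ g = ∑ i, ((hN.eigenvectorBasis i).ofLp ⬝ᵥ f) * ((hN.eigenvectorBasis i).ofLp ⬝ᵥ g) := by
  have h := hN.eigenvectorBasis.sum_inner_mul_inner (WithLp.toLp 2 f) (WithLp.toLp 2 g)
  simp only [EuclideanSpace.inner_eq_star_dotProduct, star_trivial] at h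
  rw [dotProduct_comm f g, ← h]
  refine Finset.sum_congr rfl fun i _ => ?_
  rw [dotProduct_comm g]

theorem eigenvectorBasis_dotProduct_mulVec {N : Matrix V V ℝ} (hN : N.IsHermitian) (g : V → ℝ)
    (i : V) : (hN.eigenvectorBasis i).ofLp ⬝ᵥ (N *ᵥ g)
      = hN.eigenvalues i * ((hN.eigenvectorBasis i).ofLp ⬝ᵥ g) := by
  have hT : Nᵀ = N := by simpa [IsHermitian, conjTranspose] using! hN
  rw [dotProduct_mulVec, ← mulVec_transpose, hT, hN.mulVec_eigenvectorBasis, smul_dotProduct,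
    smul_eq_mul]

/-- On the orthogonal complement of a fixed vector, a symmetric matrix is bounded by the largest
absolute value of its eigenvalues, one copy of `1` removed. -/
theorem abs_dotProduct_mulVec_le {N : Matrix V V ℝ} (hN : N.IsHermitian) {u : V → ℝ} (hu : u ≠ 0)
    (hNu : N *ᵥ u = u) {f : V → ℝ} (hf : u ⬝ᵥ f = 0) (g : V → ℝ) :
    |f ⬝ᵥ (N *ᵥ g)| ≤ ((((N.charpoly.roots.erase 1).map fun μ : ℝ => ‖μ‖₊).sup : NNReal) : ℝ)
      * (√(f ⬝ᵥ f) * √(g ⬝ᵥ g)) := by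
  set e : V → V → ℝ := fun i => (hN.eigenvectorBasis i).ofLp with he
  set l : ℝ := ((((N.charpoly.roots.erase 1).map fun μ : ℝ => ‖μ‖₊).sup : NNReal) : ℝ) with hl
  have hl0 : 0 ≤ l := NNReal.coe_nonneg _
  have hpar : ∀ f g : V → ℝ, f ⬝ᵥ g = ∑ i, (e i ⬝ᵥ f) * (e i ⬝ᵥ g) :=
    dotProduct_eq_sum_eigenvectorBasis hN
  have hev : ∀ (g : V → ℝ) (i : V), e i ⬝ᵥ (N *ᵥ g) = hN.eigenvalues i * (e i ⬝ᵥ g) :=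
    eigenvectorBasis_dotProduct_mulVec hN
  have hfix : ∀ i, hN.eigenvalues i ≠ 1 → e i ⬝ᵥ u = 0 := by
    intro i hi
    have h := hev u i
    rw [hNu] at h
    have : (hN.eigenvalues i - 1) * (e i ⬝ᵥ u) = 0 := by linarith
    exact (mul_eq_zero.1 this).resolve_left (sub_ne_zero.2 hi)
  -- `i₀` is the index whose eigenvalue is the erased copy of `1`; it exists because `u` has
  -- components only along eigenvalue `1`.
  obtain ⟨i₀, hi₀, hi₀u⟩ : ∃ i, hN.eigenvalues i = 1 ∧ e i ⬝ᵥ u ≠ 0 := by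
    by_contra! hcon
    apply hu
    rw [← dotProduct_self_eq_zero, hpar]
    refine Finset.sum_eq_zero fun i _ => ?_
    by_cases hi : hN.eigenvalues i = 1
    · rw [hcon i hi, zero_mul]
    · rw [hfix i hi, zero_mul]
  have hroots : N.charpoly.roots.erase 1
      = (Finset.univ.erase i₀).val.map hN.eigenvalues := by
    have h := hN.roots_charpoly_eq_eigenvalues
    have h2 : (Finset.univ : Finset V).val = i₀ ::ₘ (Finset.univ.erase i₀).val := by
      rw [Finset.erase_val, Multiset.cons_erase (Finset.mem_univ_val i₀)]
    rw [h, h2, Multiset.map_cons, Function.comp_apply, hi₀, RCLike.ofReal_one,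
      Multiset.erase_cons_head]
    rfl
  have hle : ∀ i, i ≠ i₀ → |hN.eigenvalues i| ≤ l := by
    intro i hi
    rw [hl, hroots, ← Real.norm_eq_abs, ← coe_nnnorm, NNReal.coe_le_coe]
    refine Multiset.le_sup (Multiset.mem_map_of_mem _ (Multiset.mem_map_of_mem _ ?_))
    exact Finset.mem_erase.2 ⟨hi, Finset.mem_univ i⟩
  have hterm : ∀ i, |(e i ⬝ᵥ f) * (hN.eigenvalues i * (e i ⬝ᵥ g))|
      ≤ l * (|e i ⬝ᵥ f| * |e i ⬝ᵥ g|) := by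
    intro i
    rw [abs_mul, abs_mul, mul_left_comm]
    by_cases hi : i = i₀
    -- If `1` is a multiple eigenvalue, then `l ≥ 1` and nothing is lost. If it is simple, `u` is a
    -- multiple of `e i₀`, so `f` has no component there.
    · by_cases hmult : ∃ j, j ≠ i₀ ∧ hN.eigenvalues j = 1
      · obtain ⟨j, hj, hj1⟩ := hmult
        have := hle j hj
        rw [hj1] at this
        rw [hi, hi₀]
        gcongr
      · push Not at hmult
        have h0 : e i ⬝ᵥ f = 0 := by
          have h := hpar u f
          rw [hf, Finset.sum_eq_single i₀ (fun j _ hj => by rw [hfix j (hmult j hj), zero_mul])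
            (by simp)] at h
          rw [hi]
          exact (mul_eq_zero.1 h.symm).resolve_left hi₀u
        simp [h0]
    · gcongr
      exact hle i hi
  rw [hpar]
  simp_rw [hev]
  calc _ ≤ ∑ i, |(e i ⬝ᵥ f) * (hN.eigenvalues i * (e i ⬝ᵥ g))| := Finset.abs_sum_le_sum_abs _ _
    _ ≤ ∑ i, l * (|e i ⬝ᵥ f| * |e i ⬝ᵥ g|) := Finset.sum_le_sum fun i _ => hterm i
    _ = l * ∑ i, |e i ⬝ᵥ f| * |e i ⬝ᵥ g| := by rw [Finset.mul_sum]
    _ ≤ l * (√(∑ i, |e i ⬝ᵥ f| ^ 2) * √(∑ i, |e i ⬝ᵥ g| ^ 2)) := by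
      gcongr
      exact Real.sum_mul_le_sqrt_mul_sqrt _ _ _
    _ = _ := by
      simp_rw [sq_abs, sq]
      rw [← hpar, ← hpar]

end Spectral

/-! ### Reversibility and the expander mixing lemma. -/

section Mixing

open Matrix

variable {V : Type*} [Fintype V] (G : SimpleGraph V) [DecidableRel G.Adj]

/-- The stationary measure of a set of vertices. -/
noncomputable def mass (A : Finset V) : ℝ := ∑ v ∈ A, stationary G v

/-- The stationary flow `∑ π_v P(v,w)` from `A` to `B`. -/
noncomputable def flow (A B : Finset V) : ℝ :=
  ∑ v ∈ A, ∑ w ∈ B, stationary G v * walkMatrix G v w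

theorem stationary_nonneg (v : V) : 0 ≤ stationary G v := by
  unfold stationary; positivity

variable {G} in
theorem stationary_pos (hdeg : ∀ v, 0 < G.degree v) (v : V) : 0 < stationary G v := by
  have hm : 0 < G.edgeFinset.card := by
    have h := G.sum_degrees_eq_twice_card_edges
    have h2 : G.degree v ≤ ∑ v, G.degree v :=
      Finset.single_le_sum (f := fun v => G.degree v) (fun _ _ => Nat.zero_le _) (Finset.mem_univ v)
    have := hdeg v
    omega
  have := hdeg v
  unfold stationary; positivity

variable {G} in
theorem sum_stationary [Nonempty V] (hdeg : ∀ v, 0 < G.degree v) : ∑ v, stationary G v = 1 := by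
  obtain ⟨v₀⟩ := ‹Nonempty V›
  have h := G.sum_degrees_eq_twice_card_edges
  have hpos := stationary_pos hdeg v₀
  unfold stationary at hpos ⊢
  rw [← Finset.sum_div]
  have h' : (∑ v, (G.degree v : ℝ)) = 2 * (G.edgeFinset.card : ℝ) := by exact_mod_cast h
  rw [h', div_self]
  rintro h0
  simp [h0] at hpos

theorem stationary_mul_walkMatrix (hdeg : ∀ v, 0 < G.degree v) (v w : V) :
    stationary G v * walkMatrix G v w
      = if G.Adj v w then 1 / (2 * (G.edgeFinset.card : ℝ)) else 0 := by
  have := hdeg v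
  simp only [stationary, walkMatrix, Matrix.of_apply]
  split_ifs
  · field_simp
  · simp

theorem stationary_mul_walkMatrix_comm (hdeg : ∀ v, 0 < G.degree v) (v w : V) :
    stationary G v * walkMatrix G v w = stationary G w * walkMatrix G w v := by
  simp_rw [stationary_mul_walkMatrix G hdeg, G.adj_comm]

theorem flow_comm (hdeg : ∀ v, 0 < G.degree v) (A B : Finset V) : flow G A B = flow G B A := by
  unfold flow
  rw [Finset.sum_comm]
  simp_rw [stationary_mul_walkMatrix_comm G hdeg]

/-- The symmetrised transition matrix `D^{1/2} P D^{-1/2}`. -/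
noncomputable def symWalk (v w : V) : ℝ :=
  √(stationary G v) * walkMatrix G v w * (√(stationary G w))⁻¹

variable [DecidableEq V]

/-- The **expander mixing lemma** for the simple random walk. -/
theorem abs_flow_sub_le [Nonempty V] (hdeg : ∀ v, 0 < G.degree v) (A B : Finset V) :
    |flow G A B - mass G A * mass G B| ≤ secondEigenvalue G *
      (√(mass G A * (1 - mass G A)) * √(mass G B * (1 - mass G B))) := by
  set u : V → ℝ := fun v => √(stationary G v) with hu
  have hupos : ∀ v, 0 < u v := fun v => Real.sqrt_pos.2 (stationary_pos hdeg v)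
  have husq : ∀ v, u v * u v = stationary G v := fun v => Real.mul_self_sqrt (stationary_nonneg G v)
  set N : Matrix V V ℝ := Matrix.of (symWalk G) with hNdef
  have hNapp : ∀ v w, N v w = u v * walkMatrix G v w * (u w)⁻¹ := fun v w => rfl
  have huN : ∀ v w, u v * N v w * u w = stationary G v * walkMatrix G v w := by
    intro v w
    have := (hupos w).ne'
    rw [hNapp, ← husq v]
    field_simp
  have hN : N.IsHermitian := by
    ext v w
    simp only [conjTranspose_apply, star_trivial]
    have h : u w * N w v * u v = u v * N v w * u w := by
      rw [huN, huN, stationary_mul_walkMatrix_comm G hdeg]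
    have h1 := (hupos v).ne'
    have h2 := (hupos w).ne'
    have h3 : (u v * u w) * N w v = (u v * u w) * N v w := by linarith
    exact mul_left_cancel₀ (mul_ne_zero h1 h2) h3
  -- `N` is similar to `P`, so `secondEigenvalue`, defined from the roots for `P`, applies to `N`.
  have hchar : N.charpoly = (walkMatrix G).charpoly := by
    have hprod : N = Matrix.diagonal u * walkMatrix G * Matrix.diagonal fun v => (u v)⁻¹ := by
      ext v w
      rw [Matrix.mul_diagonal, Matrix.diagonal_mul, hNapp]
    rw [hprod, Matrix.charpoly_mul_comm, ← mul_assoc, Matrix.diagonal_mul_diagonal]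
    have : (fun i => (u i)⁻¹ * u i) = fun _ => (1 : ℝ) := by
      ext i
      exact inv_mul_cancel₀ (hupos i).ne'
    rw [this, Matrix.diagonal_one, one_mul]
  have hNu : N *ᵥ u = u := by
    ext v
    have : ∀ w, N v w * u w = u v * walkMatrix G v w := by
      intro w
      have := (hupos w).ne'
      rw [hNapp]
      field_simp
    simp only [mulVec, dotProduct, this]
    rw [← Finset.mul_sum, sum_walkMatrix_row G (hdeg v), mul_one]
  have hu0 : u ≠ 0 := by
    obtain ⟨v₀⟩ := ‹Nonempty V›
    intro h
    exact (hupos v₀).ne' (congrFun h v₀)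
  have huu : u ⬝ᵥ u = 1 := by
    simp only [dotProduct, husq]
    exact sum_stationary hdeg
  set ind : Finset V → V → ℝ := fun A v => if v ∈ A then u v else 0 with hind
  have hindu : ∀ A, u ⬝ᵥ ind A = mass G A := by
    intro A
    simp only [dotProduct, hind, mul_ite, mul_zero, husq, mass]
    simp
  have hindind : ∀ A, ind A ⬝ᵥ ind A = mass G A := by
    intro A
    simp only [dotProduct, hind, mul_ite, ite_mul, zero_mul, mul_zero, husq, mass]
    simp
  have hflow : ind A ⬝ᵥ (N *ᵥ ind B) = flow G A B := by
    simp only [dotProduct, mulVec, hind, flow, ← huN]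
    simp [Finset.mul_sum, mul_assoc]
  -- Removing the component along `u` subtracts the product of the masses from the flow and leaves
  -- the variances `π(A)(1 - π(A))` as squared norms.
  have hproj : ∀ A, u ⬝ᵥ (ind A - mass G A • u) = 0 := by
    intro A
    rw [dotProduct_sub, dotProduct_smul, hindu, huu]
    simp
  have hnorm : ∀ A, (ind A - mass G A • u) ⬝ᵥ (ind A - mass G A • u)
      = mass G A * (1 - mass G A) := by
    intro A
    rw [sub_dotProduct, smul_dotProduct, hproj, dotProduct_sub, hindind, dotProduct_smul,
      dotProduct_comm, hindu]
    simp only [smul_eq_mul]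
    ring
  have hNT : Nᵀ = N := by simpa [IsHermitian, conjTranspose] using! hN
  have huNf : ∀ f : V → ℝ, u ⬝ᵥ (N *ᵥ f) = u ⬝ᵥ f := by
    intro f
    rw [dotProduct_mulVec, ← mulVec_transpose, hNT, hNu]
  have hval : (ind A - mass G A • u) ⬝ᵥ (N *ᵥ (ind B - mass G B • u))
      = flow G A B - mass G A * mass G B := by
    rw [sub_dotProduct, smul_dotProduct, huNf, hproj, mulVec_sub, mulVec_smul, hNu,
      dotProduct_sub, dotProduct_smul, hflow, dotProduct_comm _ u, hindu]
    simp only [smul_eq_mul]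
    ring
  have := abs_dotProduct_mulVec_le hN hu0 hNu (hproj A) (ind B - mass G B • u)
  rwa [hval, hnorm, hnorm, hchar] at this

end Mixing

/-! ### Taylor bounds for the square root. -/

/-- The second-order term is kept because it is the only source of drift when the first-order flows
may vanish. For increments the first order in `sqrt_add_le` suffices. -/
theorem sqrt_sub_le {a d : ℝ} (ha : 0 < a) (hd : 0 ≤ d) (hda : d ≤ a) :
    √(a - d) ≤ √a * (1 - d / (2 * a) - d ^ 2 / (8 * a ^ 2)) := by
  obtain ⟨y, rfl⟩ : ∃ y, d = a * y := ⟨d / a, by field_simp⟩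
  have hy0 : 0 ≤ y := nonneg_of_mul_nonneg_right hd ha
  have hy1 : y ≤ 1 := by
    by_contra! h
    nlinarith
  have e1 : a - a * y = a * (1 - y) := by ring
  have e2 : 1 - a * y / (2 * a) - (a * y) ^ 2 / (8 * a ^ 2) = 1 - y / 2 - y ^ 2 / 8 := by
    field_simp
  rw [e1, e2, Real.sqrt_mul ha.le]
  gcongr
  refine Real.sqrt_le_iff.2 ⟨by nlinarith, ?_⟩
  -- This is exactly `(1 - y/2 - y²/8)² - (1 - y)`.
  have : 0 ≤ y ^ 3 / 8 + y ^ 4 / 64 := by positivity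
  nlinarith

theorem sqrt_add_le {a d : ℝ} (ha : 0 < a) (hd : 0 ≤ d) :
    √(a + d) ≤ √a * (1 + d / (2 * a)) := by
  have e1 : a + d = a * (1 + d / a) := by field_simp
  rw [e1, Real.sqrt_mul ha.le]
  gcongr
  refine Real.sqrt_le_iff.2 ⟨by positivity, ?_⟩
  have : (1 + d / (2 * a)) ^ 2 = 1 + d / a + (d / (2 * a)) ^ 2 := by field_simp; ring
  rw [this]
  nlinarith [sq_nonneg (d / (2 * a))]

/-! ### Masses and lower bounds on flows. -/

section Mass

variable {V : Type*} [Fintype V] {G : SimpleGraph V} [DecidableRel G.Adj]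

theorem mass_nonneg (A : Finset V) : 0 ≤ mass G A :=
  Finset.sum_nonneg fun v _ => stationary_nonneg G v

theorem mass_le_one [Nonempty V] (hdeg : ∀ v, 0 < G.degree v) (A : Finset V) : mass G A ≤ 1 := by
  rw [← sum_stationary hdeg]
  exact Finset.sum_le_sum_of_subset_of_nonneg (Finset.subset_univ A)
    fun v _ _ => stationary_nonneg G v

theorem mass_pos (hdeg : ∀ v, 0 < G.degree v) {A : Finset V} (hA : A.Nonempty) : 0 < mass G A :=
  Finset.sum_pos (fun v _ => stationary_pos hdeg v) hA

theorem flow_nonneg (A B : Finset V) : 0 ≤ flow G A B :=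
  Finset.sum_nonneg fun v _ => Finset.sum_nonneg fun w _ =>
    mul_nonneg (stationary_nonneg G v) (walkMatrix_nonneg G v w)

variable [DecidableEq V]

theorem mass_union {A B : Finset V} (h : Disjoint A B) : mass G (A ∪ B) = mass G A + mass G B :=
  Finset.sum_union h

theorem mass_add_mass_le_one [Nonempty V] (hdeg : ∀ v, 0 < G.degree v) {A B : Finset V}
    (h : Disjoint A B) : mass G A + mass G B ≤ 1 :=
  mass_union (G := G) h ▸ mass_le_one hdeg _

theorem mass_compl [Nonempty V] (hdeg : ∀ v, 0 < G.degree v) (A : Finset V) :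
    mass G Aᶜ = 1 - mass G A := by
  rw [eq_sub_iff_add_eq', ← sum_stationary hdeg]
  exact Finset.sum_add_sum_compl A _

theorem one_le_mass_add_mass [Nonempty V] (hdeg : ∀ v, 0 < G.degree v) {A B : Finset V}
    (h : A ∪ B = Finset.univ) : 1 ≤ mass G A + mass G B := by
  have h1 : mass G Aᶜ ≤ mass G B := by
    refine Finset.sum_le_sum_of_subset_of_nonneg (fun v hv => ?_)
      fun v _ _ => stationary_nonneg G v
    have := Finset.mem_univ v
    rw [← h, Finset.mem_union] at this
    exact this.resolve_left (Finset.mem_compl.1 hv)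
  rw [mass_compl hdeg] at h1
  linarith

theorem flow_union_right {A B C : Finset V} (h : Disjoint B C) :
    flow G A (B ∪ C) = flow G A B + flow G A C := by
  simp_rw [flow, Finset.sum_union h, Finset.sum_add_distrib]

theorem secondEigenvalue_nonneg : 0 ≤ secondEigenvalue G := NNReal.coe_nonneg _

variable [Nonempty V]

theorem le_flow (hdeg : ∀ v, 0 < G.degree v) (A B : Finset V) :
    mass G A * mass G B - secondEigenvalue G * (√(mass G A) * √(mass G B)) ≤ flow G A B := by
  have h := (abs_le.1 (abs_flow_sub_le G hdeg A B)).1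
  have h1 : ∀ A : Finset V, √(mass G A * (1 - mass G A)) ≤ √(mass G A) := fun A =>
    Real.sqrt_le_sqrt (mul_le_of_le_one_right (mass_nonneg A) (by linarith [mass_nonneg (G := G) A]))
  have h2 : secondEigenvalue G * (√(mass G A * (1 - mass G A)) * √(mass G B * (1 - mass G B)))
      ≤ secondEigenvalue G * (√(mass G A) * √(mass G B)) :=
    mul_le_mul_of_nonneg_left (mul_le_mul (h1 A) (h1 B) (Real.sqrt_nonneg _) (Real.sqrt_nonneg _))
      secondEigenvalue_nonneg
  linarith

/-- For a set and its complement the mixing error is `λ` times the main term, so the bound stays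
useful for sets of any mass, however small or close to full. -/
theorem le_flow_compl (hdeg : ∀ v, 0 < G.degree v) (A : Finset V) :
    (1 - secondEigenvalue G) * (mass G A * (1 - mass G A)) ≤ flow G A Aᶜ := by
  have h := (abs_le.1 (abs_flow_sub_le G hdeg A Aᶜ)).1
  rw [mass_compl hdeg, sub_sub_cancel, mul_comm (1 - mass G A) (mass G A),
    Real.mul_self_sqrt (mul_nonneg (mass_nonneg A) (by linarith [mass_le_one hdeg A]))] at h
  linarith

end Mass

/-! ### One-step change of the extreme masses. -/

section Boundary

/-- Reflecting the opinions carries results for the smallest opinion over to the largest. -/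
theorem update_neg {V : Type*} [DecidableEq V] (X : V → ℤ) (c : V × V) : update (-X) c = -update X c := by
  ext v
  simp only [update, Function.update_apply, Pi.neg_apply]
  split_ifs <;> omega

variable {V : Type*} [Fintype V]

/-- The vertices of opinion `i`. -/
def levelSet (X : V → ℤ) (i : ℤ) : Finset V := Finset.univ.filter fun v => X v = i

@[simp] theorem mem_levelSet {X : V → ℤ} {i : ℤ} {v : V} : v ∈ levelSet X i ↔ X v = i := by
  simp [levelSet]

theorem levelSet_neg (X : V → ℤ) (i : ℤ) : levelSet (-X) (-i) = levelSet X i := by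
  ext v; simp

theorem disjoint_levelSet (X : V → ℤ) {i j : ℤ} (h : i ≠ j) :
    Disjoint (levelSet X i) (levelSet X j) := by
  rw [Finset.disjoint_left]
  intro v hi hj
  exact h ((mem_levelSet.1 hi).symm.trans (mem_levelSet.1 hj))

variable [DecidableEq V]

variable (G : SimpleGraph V) [DecidableRel G.Adj]

/-- A bound on the relative change of `√(π(A))` at the choice `(v, w)`, where `A` is the set of
vertices of an extreme opinion and `B` that of the next one. -/
noncomputable def boundaryGain (A B : Finset V) (p : ℝ) (v w : V) : ℝ :=
  (if v ∈ A ∧ w ∈ Aᶜ then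
      stationary G v * -(1 / (2 * mass G A) * (1 + p / (4 * mass G A))) else 0) +
    (if v ∈ B ∧ w ∈ A then stationary G v * (1 / (2 * mass G A)) else 0)

/-- By reversibility the first-order gain from `B` cancels the first-order loss of `A` towards `B`;
only the flow from `A` past `B` and the second-order loss survive. -/
theorem sum_walkMatrix_mul_boundaryGain (hdeg : ∀ v, 0 < G.degree v) {A B : Finset V}
    (hAB : Disjoint A B) (p : ℝ) :
    ∑ v, ∑ w, walkMatrix G v w * boundaryGain G A B p v w
      = -(1 / (2 * mass G A) * (flow G A (Aᶜ \ B) + p / (4 * mass G A) * flow G A Aᶜ)) := by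
  have hsum : ∀ (A B : Finset V) (κ : ℝ), ∑ v, ∑ w, walkMatrix G v w *
      (if v ∈ A ∧ w ∈ B then stationary G v * κ else 0) = flow G A B * κ := by
    intro A B κ
    have hrow : ∀ v, ∑ w, walkMatrix G v w * (if v ∈ A ∧ w ∈ B then stationary G v * κ else 0)
        = if v ∈ A then (∑ w ∈ B, stationary G v * walkMatrix G v w) * κ else 0 := by
      intro v
      by_cases hv : v ∈ A
      · simp only [hv, true_and, if_true, mul_ite, mul_zero, Finset.sum_ite_mem,
          Finset.univ_inter, Finset.sum_mul]
        exact Finset.sum_congr rfl fun w _ => by ring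
      · simp [hv]
    simp_rw [hrow, Finset.sum_ite_mem, Finset.univ_inter, flow, Finset.sum_mul]
  simp_rw [boundaryGain, mul_add, Finset.sum_add_distrib, hsum]
  have hBA : B ⊆ Aᶜ := fun v hv =>
    Finset.mem_compl.2 fun hvA => Finset.disjoint_left.1 hAB hvA hv
  have hsplit : flow G A Aᶜ = flow G A B + flow G A (Aᶜ \ B) := by
    rw [← flow_union_right Finset.disjoint_sdiff, Finset.union_sdiff_of_subset hBA]
  rw [flow_comm G hdeg B A, hsplit]
  ring

/-- The effect of one step on the mass of the smallest opinion. -/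
theorem sqrt_mass_levelSet_update_le (hdeg : ∀ v, 0 < G.degree v) {p : ℝ}
    (hp : ∀ v, p ≤ stationary G v) {X : V → ℤ} {s : ℤ} (hs : ∀ v, s ≤ X v)
    (hne : (levelSet X s).Nonempty) (v w : V) :
    √(mass G (levelSet (update X (v, w)) s)) ≤ √(mass G (levelSet X s)) *
      (1 + boundaryGain G (levelSet X s) (levelSet X (s + 1)) p v w) := by
  have ha := mass_pos hdeg hne
  have hpv := stationary_pos hdeg v
  set a := mass G (levelSet X s) with hadef
  have hv := hs v
  have hw := hs w
  rcases hv.eq_or_lt with hvs | hvs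
  · have hvA : v ∈ levelSet X s := mem_levelSet.2 hvs.symm
    rcases hw.eq_or_lt with hws | hws
    · have h1 : levelSet (update X (v, w)) s = levelSet X s := by
        ext u
        simp only [mem_levelSet, update, Function.update_apply]
        split_ifs <;> first | omega | (subst_vars; omega)
      have h2 : boundaryGain G (levelSet X s) (levelSet X (s + 1)) p v w = 0 := by
        unfold boundaryGain
        rw [if_neg (by simp; omega), if_neg (by simp; omega), add_zero]
      rw [h1, h2, add_zero, mul_one]
    · have h1 : levelSet (update X (v, w)) s = (levelSet X s).erase v := by
        ext u
        simp only [mem_levelSet, update, Function.update_apply, Finset.mem_erase]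
        split_ifs <;> first | omega | simp_all
      have h2 : boundaryGain G (levelSet X s) (levelSet X (s + 1)) p v w
          = stationary G v * -(1 / (2 * a) * (1 + p / (4 * a))) := by
        unfold boundaryGain
        rw [if_pos (by simp; omega), if_neg (by simp; omega), add_zero]
      have h3 : mass G ((levelSet X s).erase v) = a - stationary G v := by
        rw [hadef, mass, mass, ← Finset.add_sum_erase _ _ hvA]
        ring
      have h4 : stationary G v ≤ a := by
        have := mass_nonneg (G := G) ((levelSet X s).erase v)
        linarith
      rw [h1, h2, h3]
      refine (sqrt_sub_le ha hpv.le h4).trans (mul_le_mul_of_nonneg_left ?_ (Real.sqrt_nonneg _))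
      -- Replacing one factor `π_v` by `p` makes the quadratic term linear in `π_v`, so that it sums
      -- to a flow.
      have h5 : stationary G v * p / (8 * a ^ 2) ≤ stationary G v ^ 2 / (8 * a ^ 2) := by
        rw [sq (stationary G v)]
        gcongr
        exact hp v
      have h6 : stationary G v * -(1 / (2 * a) * (1 + p / (4 * a)))
          = -(stationary G v / (2 * a)) - stationary G v * p / (8 * a ^ 2) := by
        field_simp
        ring
      rw [h6]
      linarith
  · by_cases hup : X v = s + 1 ∧ X w = s
    · have hvA : v ∉ levelSet X s := by simp; omega
      have h1 : levelSet (update X (v, w)) s = insert v (levelSet X s) := by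
        ext u
        simp only [mem_levelSet, update, Function.update_apply, Finset.mem_insert]
        split_ifs <;> first | omega | simp_all
      have h2 : boundaryGain G (levelSet X s) (levelSet X (s + 1)) p v w
          = stationary G v * (1 / (2 * a)) := by
        unfold boundaryGain
        rw [if_neg (by simp; omega), if_pos (by simp; omega), zero_add]
      have h3 : mass G (insert v (levelSet X s)) = a + stationary G v := by
        rw [hadef, mass, mass, Finset.sum_insert hvA, add_comm]
      rw [h1, h2, h3]
      convert sqrt_add_le ha hpv.le using 3
      ring
    · have h1 : levelSet (update X (v, w)) s = levelSet X s := by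
        ext u
        simp only [mem_levelSet, update, Function.update_apply]
        split_ifs <;> first | omega | (subst_vars; omega)
      have h2 : boundaryGain G (levelSet X s) (levelSet X (s + 1)) p v w = 0 := by
        unfold boundaryGain
        rw [if_neg (by simp; omega), if_neg (by simpa using hup), add_zero]
      rw [h1, h2, add_zero, mul_one]

/-- The effect of one step on the mass of the largest opinion. -/
theorem sqrt_mass_levelSet_update_le' (hdeg : ∀ v, 0 < G.degree v) {p : ℝ}
    (hp : ∀ v, p ≤ stationary G v) {X : V → ℤ} {l : ℤ} (hl : ∀ v, X v ≤ l)
    (hne : (levelSet X l).Nonempty) (v w : V) :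
    √(mass G (levelSet (update X (v, w)) l)) ≤ √(mass G (levelSet X l)) *
      (1 + boundaryGain G (levelSet X l) (levelSet X (l - 1)) p v w) := by
  have h := sqrt_mass_levelSet_update_le G hdeg hp (X := -X) (s := -l)
    (fun v => neg_le_neg (hl v)) (by rwa [levelSet_neg]) v w
  rwa [update_neg, levelSet_neg, levelSet_neg, show -l + 1 = -(l - 1) by ring, levelSet_neg] at h

/-- The geometric mean of the masses of the opinions `s` and `l`. -/
noncomputable def extremeMass (X : V → ℤ) (s l : ℤ) : ℝ :=
  √(mass G (levelSet X s)) * √(mass G (levelSet X l))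

/-- The mean of a function of the opinions after one step. -/
noncomputable def stepMean (F : (V → ℤ) → ℝ) (X : V → ℤ) : ℝ :=
  ∑ v, ∑ w, 1 / (Fintype.card V : ℝ) * walkMatrix G v w * F (update X (v, w))

theorem stepMean_mono {F F' : (V → ℤ) → ℝ} {X : V → ℤ}
    (h : ∀ v w, F (update X (v, w)) ≤ F' (update X (v, w))) :
    stepMean G F X ≤ stepMean G F' X :=
  Finset.sum_le_sum fun v _ => Finset.sum_le_sum fun w _ => mul_le_mul_of_nonneg_left (h v w)
    (mul_nonneg (by positivity) (walkMatrix_nonneg G v w))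

theorem stepMean_affine [Nonempty V] (hdeg : ∀ v, 0 < G.degree v) (c κ : ℝ) (F : (V → ℤ) → ℝ)
    (X : V → ℤ) : stepMean G (fun Y => c + κ * F Y) X = c + κ * stepMean G F X := by
  calc stepMean G (fun Y => c + κ * F Y) X
      = c * ∑ v, ∑ w, 1 / (Fintype.card V : ℝ) * walkMatrix G v w + κ * stepMean G F X := by
        simp_rw [stepMean, Finset.mul_sum, ← Finset.sum_add_distrib]
        exact Finset.sum_congr rfl fun v _ => Finset.sum_congr rfl fun w _ => by ring
    _ = _ := by rw [sum_walkMatrix_div_card G hdeg, mul_one]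

/-- The drift of the geometric mean of the masses of the two extreme opinions. -/
theorem stepMean_extremeMass_le [Nonempty V] (hdeg : ∀ v, 0 < G.degree v) {p : ℝ}
    (hp : ∀ v, p ≤ stationary G v) {X : V → ℤ} {s l : ℤ} (hs : ∀ v, s ≤ X v) (hl : ∀ v, X v ≤ l)
    (hsne : (levelSet X s).Nonempty) (hlne : (levelSet X l).Nonempty) (hsl : s + 2 ≤ l) :
    stepMean G (fun Y => extremeMass G Y s l) X ≤ extremeMass G X s l -
      extremeMass G X s l / (2 * Fintype.card V) *
        ((flow G (levelSet X s) ((levelSet X s)ᶜ \ levelSet X (s + 1)) / mass G (levelSet X s) +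
          flow G (levelSet X l) ((levelSet X l)ᶜ \ levelSet X (l - 1)) / mass G (levelSet X l)) +
        p / 4 * (flow G (levelSet X s) (levelSet X s)ᶜ / mass G (levelSet X s) ^ 2 +
          flow G (levelSet X l) (levelSet X l)ᶜ / mass G (levelSet X l) ^ 2)) := by
  set z := extremeMass G X s l with hz
  set gs := boundaryGain G (levelSet X s) (levelSet X (s + 1)) p with hgs
  set gl := boundaryGain G (levelSet X l) (levelSet X (l - 1)) p with hgl
  have ha := mass_pos hdeg hsne
  have hb := mass_pos hdeg hlne
  have hn : (0 : ℝ) < Fintype.card V := by exact_mod_cast Fintype.card_pos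
  have hpt : ∀ v w, extremeMass G (update X (v, w)) s l ≤ z * (1 + gs v w + gl v w) := by
    intro v w
    have h1 := sqrt_mass_levelSet_update_le G hdeg hp hs hsne v w
    have h2 := sqrt_mass_levelSet_update_le' G hdeg hp hl hlne v w
    -- Only `v` moves. As `s + 2 ≤ l`, it could affect both extremes only by lying in the common
    -- middle opinion when `l = s + 2`, and then `w` would have to hold both `s` and `l`.
    have h3 : gs v w * gl v w = 0 := by
      rw [hgs, hgl, boundaryGain, boundaryGain]
      simp only [Finset.mem_compl, mem_levelSet]
      split_ifs <;> first | (exfalso; omega) | simp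
    calc _ ≤ _ := mul_le_mul h1 h2 (Real.sqrt_nonneg _) ((Real.sqrt_nonneg _).trans h1)
      _ = z * (1 + gs v w + gl v w + gs v w * gl v w) := by
        rw [hz, extremeMass]; ring
      _ = _ := by rw [h3, add_zero]
  have hS := sum_walkMatrix_mul_boundaryGain G hdeg
    (disjoint_levelSet X (show s ≠ s + 1 by omega)) p
  have hL := sum_walkMatrix_mul_boundaryGain G hdeg
    (disjoint_levelSet X (show l ≠ l - 1 by omega)) p
  calc stepMean G (fun Y => extremeMass G Y s l) X
      ≤ ∑ v, ∑ w, 1 / (Fintype.card V : ℝ) * walkMatrix G v w * (z * (1 + gs v w + gl v w)) :=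
        Finset.sum_le_sum fun v _ => Finset.sum_le_sum fun w _ =>
          mul_le_mul_of_nonneg_left (hpt v w)
            (mul_nonneg (by positivity) (walkMatrix_nonneg G v w))
    _ = z * ∑ v, ∑ w, 1 / (Fintype.card V : ℝ) * walkMatrix G v w +
        z / Fintype.card V * ∑ v, ∑ w, walkMatrix G v w * gs v w +
        z / Fintype.card V * ∑ v, ∑ w, walkMatrix G v w * gl v w := by
        simp_rw [Finset.mul_sum, ← Finset.sum_add_distrib]
        exact Finset.sum_congr rfl fun v _ => Finset.sum_congr rfl fun w _ => by ring
    _ = _ := by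
        rw [sum_walkMatrix_div_card G hdeg, hS, hL]
        field_simp
        ring

end Boundary

/-! ### Lower bounds on the drift of the geometric mean. -/

section Drift

variable {V : Type*} [Fintype V] (G : SimpleGraph V) [DecidableRel G.Adj]

theorem extremeMass_nonneg (X : V → ℤ) (s l : ℤ) : 0 ≤ extremeMass G X s l :=
  mul_nonneg (Real.sqrt_nonneg _) (Real.sqrt_nonneg _)

theorem extremeMass_le_one [Nonempty V] (hdeg : ∀ v, 0 < G.degree v) (X : V → ℤ) (s l : ℤ) :
    extremeMass G X s l ≤ 1 :=
  mul_le_one₀ (Real.sqrt_le_one.2 (mass_le_one hdeg _)) (Real.sqrt_nonneg _)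
    (Real.sqrt_le_one.2 (mass_le_one hdeg _))

variable [DecidableEq V] [Nonempty V]

/-- Contribution of the fluctuations: for disjoint sets of masses `a`, `b`, the quantity
`√(ab) (Q(A,Aᶜ)/a² + Q(B,Bᶜ)/b²)` is bounded below. -/
theorem fluctuation_lower_bound (hdeg : ∀ v, 0 < G.degree v) (hl : secondEigenvalue G ≤ 1 / 2)
    {A B : Finset V} (hA : A.Nonempty) (hB : B.Nonempty) (hAB : Disjoint A B) :
    1 / 2 ≤ √(mass G A) * √(mass G B) *
      (flow G A Aᶜ / mass G A ^ 2 + flow G B Bᶜ / mass G B ^ 2) := by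
  have ha := mass_pos hdeg hA
  have hb := mass_pos hdeg hB
  have hab := mass_add_mass_le_one hdeg hAB
  have key : ∀ A : Finset V, 0 < mass G A →
      1 / 2 * (1 / mass G A - 1) ≤ flow G A Aᶜ / mass G A ^ 2 := by
    intro A ha
    have h := le_flow_compl hdeg A
    have h1 := mass_le_one hdeg A
    rw [le_div_iff₀ (by positivity)]
    calc 1 / 2 * (1 / mass G A - 1) * mass G A ^ 2
        = 1 / 2 * (mass G A * (1 - mass G A)) := by field_simp
      _ ≤ (1 - secondEigenvalue G) * (mass G A * (1 - mass G A)) := by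
        refine mul_le_mul_of_nonneg_right (by linarith) (mul_nonneg ha.le (by linarith))
      _ ≤ _ := h
  have hA' := key A ha
  have hB' := key B hb
  set x := √(mass G A) with hx
  set y := √(mass G B) with hy
  have hx0 : 0 < x := Real.sqrt_pos.2 ha
  have hy0 : 0 < y := Real.sqrt_pos.2 hb
  have hxx : mass G A = x ^ 2 := (Real.sq_sqrt ha.le).symm
  have hyy : mass G B = y ^ 2 := (Real.sq_sqrt hb.le).symm
  have h1 : x * y * (1 / 2 * (1 / mass G A - 1) + 1 / 2 * (1 / mass G B - 1))
      ≤ x * y * (flow G A Aᶜ / mass G A ^ 2 + flow G B Bᶜ / mass G B ^ 2) := by gcongr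
  refine le_trans ?_ h1
  rw [hxx, hyy] at hab ⊢
  have h2 : x * y * (1 / 2 * (1 / x ^ 2 - 1) + 1 / 2 * (1 / y ^ 2 - 1))
      = (x ^ 2 + y ^ 2 - 2 * (x * y) ^ 2) / (2 * (x * y)) := by
    field_simp
    ring
  have hxy : 0 < x * y := by positivity
  rw [h2, le_div_iff₀ (by positivity)]
  -- From `x² + y² ≥ 2xy`, and `2xy ≤ 1` because `x² + y² ≤ 1` by disjointness.
  nlinarith [sq_nonneg (x - y)]

/-- Contribution of the drift when the extreme opinions are at least three apart, so that
the sets `S` and `L` of vertices two or more away from them cover all vertices. -/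
theorem drift_lower_bound_of_cover (hdeg : ∀ v, 0 < G.degree v) {A B S L : Finset V}
    (hA : A.Nonempty) (hB : B.Nonempty) (hSL : S ∪ L = Finset.univ)
    (hz : 4 * secondEigenvalue G ≤ √(mass G A) * √(mass G B)) :
    1 / 4 ≤ flow G A S / mass G A + flow G B L / mass G B := by
  have key : ∀ A S : Finset V, A.Nonempty → 4 * secondEigenvalue G ≤ √(mass G A) →
      1 / 2 ≤ mass G S → 1 / 4 ≤ flow G A S / mass G A := by
    intro A S hA hz hS
    have ha := mass_pos hdeg hA
    have h := le_flow hdeg A S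
    rw [le_div_iff₀ ha]
    have h1 : secondEigenvalue G * (√(mass G A) * √(mass G S)) ≤ mass G A / 4 := by
      have h2 : √(mass G S) ≤ 1 := Real.sqrt_le_one.2 (mass_le_one hdeg S)
      calc _ ≤ √(mass G A) / 4 * (√(mass G A) * 1) := by
            have := secondEigenvalue_nonneg (G := G)
            gcongr
            linarith
        _ = √(mass G A) ^ 2 / 4 := by ring
        _ = _ := by rw [Real.sq_sqrt ha.le]
    nlinarith
  have hA1 : √(mass G A) ≤ 1 := Real.sqrt_le_one.2 (mass_le_one hdeg A)
  have hB1 : √(mass G B) ≤ 1 := Real.sqrt_le_one.2 (mass_le_one hdeg B)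
  have h1 : 0 ≤ flow G A S / mass G A := div_nonneg (flow_nonneg _ _) (mass_nonneg _)
  have h2 : 0 ≤ flow G B L / mass G B := div_nonneg (flow_nonneg _ _) (mass_nonneg _)
  have hsum := one_le_mass_add_mass hdeg hSL
  -- One of the covering sets has mass at least `1/2`; its flow term alone gives `1/2 - 1/4`, and
  -- the other term is nonnegative.
  rcases le_total (1 / 2) (mass G S) with hS | hS
  · have := key A S hA (hz.trans (mul_le_of_le_one_right (Real.sqrt_nonneg _) hB1)) hS
    linarith
  · have := key B L hB (hz.trans (mul_le_of_le_one_left (Real.sqrt_nonneg _) hA1)) (by linarith)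
    linarith

/-- Contribution of the drift when the two extreme opinions are two apart. -/
theorem drift_lower_bound_of_pair (hdeg : ∀ v, 0 < G.degree v) {A B : Finset V}
    (hA : A.Nonempty) (hB : B.Nonempty)
    (hz : 2 * secondEigenvalue G ≤ √(mass G A) * √(mass G B)) :
    √(mass G A) * √(mass G B) ≤ flow G A B / mass G A + flow G B A / mass G B := by
  have ha := mass_pos hdeg hA
  have hb := mass_pos hdeg hB
  have h := le_flow hdeg A B
  rw [flow_comm G hdeg B A]
  set x := √(mass G A) with hx
  set y := √(mass G B) with hy
  have hx0 : 0 < x := Real.sqrt_pos.2 ha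
  have hy0 : 0 < y := Real.sqrt_pos.2 hb
  have hxx : mass G A = x ^ 2 := (Real.sq_sqrt ha.le).symm
  have hyy : mass G B = y ^ 2 := (Real.sq_sqrt hb.le).symm
  have hxy : 0 < x * y := by positivity
  rw [hxx, hyy] at h ⊢
  have h1 : (x * y) ^ 2 / 2 ≤ flow G A B := by nlinarith
  have h2 : flow G A B / x ^ 2 + flow G A B / y ^ 2
      = flow G A B * (x ^ 2 + y ^ 2) / (x * y) ^ 2 := by
    field_simp
    ring
  rw [h2, le_div_iff₀ (by positivity)]
  calc x * y * (x * y) ^ 2 = (x * y) ^ 2 / 2 * (2 * (x * y)) := by ring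
    _ ≤ flow G A B * (x ^ 2 + y ^ 2) := by
      refine mul_le_mul h1 ?_ (by positivity) (flow_nonneg _ _)
      nlinarith [sq_nonneg (x - y)]

/-- The drift of the geometric mean of the masses of the extreme opinions is negative, with
explicit bounds. -/
theorem exists_stepMean_extremeMass_le (hdeg : ∀ v, 0 < G.degree v)
    (hlam : secondEigenvalue G ≤ 1 / 2) {p : ℝ} (hp0 : 0 ≤ p)
    (hp : ∀ v, p ≤ stationary G v) {X : V → ℤ} {s l : ℤ} (hs : ∀ v, s ≤ X v) (hl : ∀ v, X v ≤ l)
    (hsne : (levelSet X s).Nonempty) (hlne : (levelSet X l).Nonempty) (hsl : s + 2 ≤ l) :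
    ∃ ρ : ℝ, stepMean G (fun Y => extremeMass G Y s l) X ≤ extremeMass G X s l - ρ ∧
      p / (16 * Fintype.card V) ≤ ρ ∧
      (l ≠ s + 2 → 4 * secondEigenvalue G ≤ extremeMass G X s l →
        extremeMass G X s l / (8 * Fintype.card V) ≤ ρ) ∧
      (l = s + 2 → 2 * secondEigenvalue G ≤ extremeMass G X s l →
        extremeMass G X s l ^ 2 / (2 * Fintype.card V) ≤ ρ) := by
  have hn : (0 : ℝ) < Fintype.card V := by exact_mod_cast Fintype.card_pos
  refine ⟨_, stepMean_extremeMass_le G hdeg hp hs hl hsne hlne hsl, ?_, ?_, ?_⟩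
  all_goals
    set z := extremeMass G X s l with hz
    set A := levelSet X s with hA
    set B := levelSet X l with hB
    have hz0 : 0 ≤ z := extremeMass_nonneg G X s l
    have hAB : Disjoint A B := disjoint_levelSet X (by omega)
    have hfl := fluctuation_lower_bound G hdeg hlam hsne hlne hAB
    set D := flow G A (Aᶜ \ levelSet X (s + 1)) / mass G A +
      flow G B (Bᶜ \ levelSet X (l - 1)) / mass G B with hD
    set E := flow G A Aᶜ / mass G A ^ 2 + flow G B Bᶜ / mass G B ^ 2 with hE
    have hD0 : 0 ≤ D := add_nonneg (div_nonneg (flow_nonneg _ _) (mass_nonneg _))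
      (div_nonneg (flow_nonneg _ _) (mass_nonneg _))
    have hE0 : 0 ≤ E := add_nonneg (div_nonneg (flow_nonneg _ _) (sq_nonneg _))
      (div_nonneg (flow_nonneg _ _) (sq_nonneg _))
  · have hfl' : 1 / 2 ≤ z * E := hfl
    calc p / (16 * Fintype.card V) = p / (8 * Fintype.card V) * (1 / 2) := by field_simp; ring
      _ ≤ p / (8 * Fintype.card V) * (z * E) := by gcongr
      _ = z / (2 * Fintype.card V) * (0 + p / 4 * E) := by field_simp; ring
      _ ≤ _ := by gcongr
  · intro hne hlz
    -- A vertex missed by both sets would hold one of `s, s + 1` and one of `l - 1, l`, impossible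
    -- once `l ≥ s + 3`.
    have hcov : (Aᶜ \ levelSet X (s + 1)) ∪ (Bᶜ \ levelSet X (l - 1)) = Finset.univ := by
      ext v
      simp only [Finset.mem_union, Finset.mem_sdiff, Finset.mem_compl, Finset.mem_univ, iff_true,
        hA, hB, mem_levelSet]
      omega
    have hdr : 1 / 4 ≤ D := drift_lower_bound_of_cover G hdeg hsne hlne hcov hlz
    calc z / (8 * Fintype.card V) = z / (2 * Fintype.card V) * (1 / 4 + 0) := by field_simp; ring
      _ ≤ _ := by
        gcongr
        positivity
  · intro heq hlz
    have h1 : Aᶜ \ levelSet X (s + 1) = B := by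
      ext v
      have := hs v
      have := hl v
      simp only [Finset.mem_sdiff, Finset.mem_compl, hA, hB, mem_levelSet]
      omega
    have h2 : Bᶜ \ levelSet X (l - 1) = A := by
      ext v
      have := hs v
      have := hl v
      simp only [Finset.mem_sdiff, Finset.mem_compl, hA, hB, mem_levelSet]
      omega
    have hdr : z ≤ D := by
      rw [hD, h1, h2]
      exact drift_lower_bound_of_pair G hdeg hsne hlne hlz
    calc z ^ 2 / (2 * Fintype.card V) = z / (2 * Fintype.card V) * (z + 0) := by field_simp; ring
      _ ≤ _ := by
        gcongr
        positivity

end Drift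

/-! ### Concave barrier functions. -/

section Barrier

/-- The concave function used as a potential. -/
noncomputable def barrier (α β ζ z : ℝ) : ℝ := α * Real.log (1 + z / ζ) + β * min z ζ

variable {α β ζ : ℝ}

theorem barrier_nonneg (hα : 0 ≤ α) (hβ : 0 ≤ β) (hζ : 0 < ζ) {z : ℝ} (hz : 0 ≤ z) :
    0 ≤ barrier α β ζ z := by
  have h1 : 0 ≤ Real.log (1 + z / ζ) := Real.log_nonneg (by
    have : 0 ≤ z / ζ := by positivity
    linarith)
  have h2 : 0 ≤ min z ζ := le_min hz hζ.le
  unfold barrier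
  positivity

theorem barrier_le (hα : 0 ≤ α) (hβ : 0 ≤ β) (hζ : 0 < ζ) {z : ℝ} (hz : 0 ≤ z) (hz1 : z ≤ 1) :
    barrier α β ζ z ≤ α * Real.log (1 + 1 / ζ) + β * ζ := by
  have : 0 ≤ z / ζ := by positivity
  unfold barrier
  gcongr
  exact min_le_right _ _

/-- Concavity: the graph lies below a supporting line at `z`, with the left slope chosen at the kink
`z = ζ`. A bound on the mean of `z'` thus passes to the barrier. -/
theorem barrier_le_tangent (hα : 0 ≤ α) (hβ : 0 ≤ β) (hζ : 0 < ζ) {z z' : ℝ} (hz : 0 ≤ z)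
    (hz' : 0 ≤ z') :
    barrier α β ζ z' ≤ barrier α β ζ z
      + (α / (ζ + z) + if z ≤ ζ then β else 0) * (z' - z) := by
  have h1 : Real.log (1 + z' / ζ) ≤ Real.log (1 + z / ζ) + (z' - z) / (ζ + z) := by
    have e : ∀ y, 1 + y / ζ = (ζ + y) / ζ := fun y => by field_simp
    have h := Real.log_le_sub_one_of_pos (x := (ζ + z') / (ζ + z)) (by positivity)
    rw [Real.log_div (by positivity) (by positivity)] at h
    rw [e, e, Real.log_div (by positivity) hζ.ne', Real.log_div (by positivity) hζ.ne']
    have : (ζ + z') / (ζ + z) - 1 = (z' - z) / (ζ + z) := by field_simp; ring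
    linarith
  have h2 : β * min z' ζ ≤ β * min z ζ + (if z ≤ ζ then β else 0) * (z' - z) := by
    split_ifs with h
    · rw [min_eq_left h, ← mul_add]
      gcongr
      rw [add_sub_cancel]
      exact min_le_left _ _
    · rw [min_eq_right (not_le.1 h).le, zero_mul, add_zero]
      gcongr
      exact min_le_right _ _
  unfold barrier
  calc _ ≤ α * (Real.log (1 + z / ζ) + (z' - z) / (ζ + z)) +
        (β * min z ζ + (if z ≤ ζ then β else 0) * (z' - z)) := by gcongr
    _ = _ := by ring

/-- The slope times the drift `ρ` must be at least one. Below `ζ` the linear part provides this;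
above, the logarithm has slope `α/(ζ + z) ≥ α/(2z)`. -/
theorem stepMean_barrier_le {V : Type*} [Fintype V] [DecidableEq V] [Nonempty V]
    (G : SimpleGraph V) [DecidableRel G.Adj] (hdeg : ∀ v, 0 < G.degree v)
    (hα : 0 ≤ α) (hβ : 0 ≤ β) (hζ : 0 < ζ) {Z : (V → ℤ) → ℝ} (hZ : ∀ Y, 0 ≤ Z Y) {X : V → ℤ}
    {ρ : ℝ} (hρ : stepMean G Z X ≤ Z X - ρ) (hρ0 : 0 ≤ ρ) (h1 : Z X ≤ ζ → 1 ≤ β * ρ)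
    (h2 : ζ < Z X → 2 * Z X ≤ α * ρ) :
    stepMean G (fun Y => barrier α β ζ (Z Y)) X ≤ barrier α β ζ (Z X) - 1 := by
  set κ := α / (ζ + Z X) + if Z X ≤ ζ then β else 0 with hκ
  have hz := hZ X
  have hκ0 : 0 ≤ κ := by
    rw [hκ]
    split_ifs <;> positivity
  have hκρ : 1 ≤ κ * ρ := by
    rcases le_or_gt (Z X) ζ with h | h
    · rw [hκ, if_pos h, add_mul]
      have : 0 ≤ α / (ζ + Z X) * ρ := by positivity
      linarith [h1 h]
    · rw [hκ, if_neg (not_le.2 h), add_zero, div_mul_eq_mul_div, le_div_iff₀ (by positivity)]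
      linarith [h2 h]
  calc _ ≤ stepMean G (fun Y => (barrier α β ζ (Z X) - κ * Z X) + κ * Z Y) X :=
        stepMean_mono G fun v w => by
          have := barrier_le_tangent hα hβ hζ hz (hZ (update X (v, w)))
          linarith
    _ = (barrier α β ζ (Z X) - κ * Z X) + κ * stepMean G Z X := stepMean_affine G hdeg _ _ _ _
    _ ≤ (barrier α β ζ (Z X) - κ * Z X) + κ * (Z X - ρ) := by gcongr
    _ ≤ _ := by linarith

end Barrier

/-! ### Stacking the barriers over the values of the range. -/

section Potential

/-- The potential of a configuration whose opinions span `r + 1` consecutive values, as a function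
of `r` and of the geometric mean `z` of the masses of the two extreme opinions; `h₂` and `h₃` are
used for `r = 2` and `r ≥ 3`, and `H₂`, `H₃` bound them. -/
noncomputable def levelPotential (h₂ h₃ : ℝ → ℝ) (H₂ H₃ : ℝ) (r : ℤ) (z : ℝ) : ℝ :=
  if r ≤ 1 then 0 else if r = 2 then h₂ z else h₃ z + (H₂ + (r - 3) * H₃)

variable {h₂ h₃ : ℝ → ℝ} {H₂ H₃ : ℝ}

theorem levelPotential_nonneg (h₂0 : ∀ z, 0 ≤ z → 0 ≤ h₂ z) (h₃0 : ∀ z, 0 ≤ z → 0 ≤ h₃ z)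
    (hH₂ : 0 ≤ H₂) (hH₃ : 0 ≤ H₃) (r : ℤ) {z : ℝ} (hz : 0 ≤ z) :
    0 ≤ levelPotential h₂ h₃ H₂ H₃ r z := by
  unfold levelPotential
  split_ifs with h1 h2
  · exact le_rfl
  · exact h₂0 z hz
  · have h3 : (3 : ℝ) ≤ r := by exact_mod_cast (show (3 : ℤ) ≤ r by omega)
    have := h₃0 z hz
    have : 0 ≤ ((r : ℝ) - 3) * H₃ := mul_nonneg (by linarith) hH₃
    linarith

theorem levelPotential_le (hH₂ : 0 ≤ H₂) (hH₃ : 0 ≤ H₃) {r : ℤ} {z : ℝ} (hz₂ : h₂ z ≤ H₂)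
    (hz₃ : h₃ z ≤ H₃) {k : ℝ} (hk : 0 ≤ k) (hr : (r : ℝ) ≤ k) :
    levelPotential h₂ h₃ H₂ H₃ r z ≤ H₂ + k * H₃ := by
  have hkH : 0 ≤ k * H₃ := mul_nonneg hk hH₃
  unfold levelPotential
  split_ifs
  · linarith
  · linarith
  · nlinarith

/-- Each range starts at a height no smaller than the maximum of the one below, so losing an extreme
opinion never raises the potential, whatever the masses of the new extremes. -/
theorem levelPotential_le_of_lt (h₂0 : ∀ z, 0 ≤ z → 0 ≤ h₂ z) (h₃0 : ∀ z, 0 ≤ z → 0 ≤ h₃ z)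
    (hH₂ : 0 ≤ H₂) (hH₃ : 0 ≤ H₃) {r r' : ℤ} (hr : r < r') {z z' : ℝ} (hz₂ : h₂ z ≤ H₂)
    (hz₃ : h₃ z ≤ H₃) (hz' : 0 ≤ z') :
    levelPotential h₂ h₃ H₂ H₃ r z ≤ levelPotential h₂ h₃ H₂ H₃ r' z' := by
  by_cases h1 : r ≤ 1
  · rw [levelPotential, if_pos h1]
    exact levelPotential_nonneg h₂0 h₃0 hH₂ hH₃ r' hz'
  have h3 : (3 : ℤ) ≤ r' := by omega
  have h3' : (3 : ℝ) ≤ r' := by exact_mod_cast h3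
  have hrr : (r : ℝ) + 1 ≤ r' := by exact_mod_cast hr
  have := h₃0 z' hz'
  unfold levelPotential
  rw [if_neg h1, if_neg (show ¬ r' ≤ 1 by omega), if_neg (show ¬ r' = 2 by omega)]
  split_ifs
  · have : 0 ≤ ((r' : ℝ) - 3) * H₃ := mul_nonneg (by linarith) hH₃
    linarith
  · nlinarith

end Potential

/-! ### The smallest and largest opinions. -/

section Range

variable {V : Type*} [Fintype V] [Nonempty V]

/-- The smallest opinion. -/
def lowest (X : V → ℤ) : ℤ := Finset.univ.inf' Finset.univ_nonempty X

/-- The largest opinion. -/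
def highest (X : V → ℤ) : ℤ := Finset.univ.sup' Finset.univ_nonempty X

theorem lowest_le (X : V → ℤ) (v : V) : lowest X ≤ X v := Finset.inf'_le _ (Finset.mem_univ v)

theorem le_highest (X : V → ℤ) (v : V) : X v ≤ highest X := Finset.le_sup' _ (Finset.mem_univ v)

theorem levelSet_lowest_nonempty (X : V → ℤ) : (levelSet X (lowest X)).Nonempty := by
  obtain ⟨v, -, hv⟩ := Finset.exists_mem_eq_inf' Finset.univ_nonempty X
  exact ⟨v, mem_levelSet.2 hv.symm⟩

theorem levelSet_highest_nonempty (X : V → ℤ) : (levelSet X (highest X)).Nonempty := by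
  obtain ⟨v, -, hv⟩ := Finset.exists_mem_eq_sup' Finset.univ_nonempty X
  exact ⟨v, mem_levelSet.2 hv.symm⟩

theorem lowest_add_two_le_highest {X : V → ℤ} (hX : ¬ TwoConsecutive X) :
    lowest X + 2 ≤ highest X := by
  by_contra! h
  refine hX ⟨lowest X, fun v => ?_⟩
  have := lowest_le X v
  have := le_highest X v
  omega

variable [DecidableEq V]

theorem lowest_le_update (X : V → ℤ) (c : V × V) : lowest X ≤ lowest (update X c) := by
  refine Finset.le_inf' _ _ fun v _ => ?_
  have h1 := lowest_le X v
  have h2 := lowest_le X c.1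
  have h3 := lowest_le X c.2
  simp only [update, Function.update_apply]
  split_ifs <;> omega

theorem highest_update_le (X : V → ℤ) (c : V × V) : highest (update X c) ≤ highest X := by
  refine Finset.sup'_le _ _ fun v _ => ?_
  have h1 := le_highest X v
  have h2 := le_highest X c.1
  have h3 := le_highest X c.2
  simp only [update, Function.update_apply]
  split_ifs <;> omega

end Range

/-! ### The expected reduction time with free thresholds. -/

/-- A bound on the expected reduction time with explicit constants, for opinions whose values
differ by at most `k`. -/
theorem lintegral_reductionTime_le_explicit {V : Type*} [Fintype V] [DecidableEq V] [Nonempty V]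
    [MeasurableSpace V] [DiscreteMeasurableSpace V] (G : SimpleGraph V) [DecidableRel G.Adj]
    (hdeg : ∀ v, 0 < G.degree v) (hlam : secondEigenvalue G ≤ 1 / 2) {p : ℝ} (hp0 : 0 < p)
    (hp : ∀ v, p ≤ stationary G v) {ζ₂ ζ₃ : ℝ} (hζ₂ : 0 < ζ₂) (hζ₃ : 0 < ζ₃)
    (hlζ₂ : 2 * secondEigenvalue G ≤ ζ₂) (hlζ₃ : 4 * secondEigenvalue G ≤ ζ₃)
    (x : V → ℤ) {k : ℝ} (hk : 0 ≤ k) (hx : ((highest x - lowest x : ℤ) : ℝ) ≤ k) :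
    ∫⁻ ω, (reductionTime x ω : ENNReal) ∂(choicesLaw G) ≤ ENNReal.ofReal
      ((4 * (Fintype.card V : ℝ) / ζ₂ * Real.log (1 + 1 / ζ₂)
          + 16 * (Fintype.card V : ℝ) / p * ζ₂) +
        k * (16 * (Fintype.card V : ℝ) * Real.log (1 + 1 / ζ₃)
          + 16 * (Fintype.card V : ℝ) / p * ζ₃)) := by
  have hn : (0 : ℝ) < Fintype.card V := by exact_mod_cast Fintype.card_pos
  set n : ℝ := (Fintype.card V : ℝ) with hndef
  -- The coefficients invert the drift bounds: `β` matches `p/(16n)`, while `16n` and `4n/ζ₂` make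
  -- `αρ ≥ 2z` when `ρ ≥ z/(8n)`, respectively `ρ ≥ z²/(2n)` with `z > ζ₂`.
  set β : ℝ := 16 * n / p with hβdef
  have hβ : 0 ≤ β := by positivity
  have hα₂ : 0 ≤ 4 * n / ζ₂ := by positivity
  have hα₃ : 0 ≤ 16 * n := by positivity
  set h₂ := barrier (4 * n / ζ₂) β ζ₂ with hh₂
  set h₃ := barrier (16 * n) β ζ₃ with hh₃
  set H₂ := 4 * n / ζ₂ * Real.log (1 + 1 / ζ₂) + β * ζ₂ with hH₂def
  set H₃ := 16 * n * Real.log (1 + 1 / ζ₃) + β * ζ₃ with hH₃def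
  have h₂0 : ∀ z, 0 ≤ z → 0 ≤ h₂ z := fun z hz => barrier_nonneg hα₂ hβ hζ₂ hz
  have h₃0 : ∀ z, 0 ≤ z → 0 ≤ h₃ z := fun z hz => barrier_nonneg hα₃ hβ hζ₃ hz
  have h₂1 : ∀ z, 0 ≤ z → z ≤ 1 → h₂ z ≤ H₂ := fun z hz => barrier_le hα₂ hβ hζ₂ hz
  have h₃1 : ∀ z, 0 ≤ z → z ≤ 1 → h₃ z ≤ H₃ := fun z hz => barrier_le hα₃ hβ hζ₃ hz
  have hH₂ : 0 ≤ H₂ := (h₂0 0 le_rfl).trans (h₂1 0 le_rfl zero_le_one)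
  have hH₃ : 0 ≤ H₃ := (h₃0 0 le_rfl).trans (h₃1 0 le_rfl zero_le_one)
  set Φ : (V → ℤ) → ℝ := fun X => levelPotential h₂ h₃ H₂ H₃ (highest X - lowest X)
    (extremeMass G X (lowest X) (highest X)) with hΦ
  have hbound := lintegral_reductionTime_le G hdeg Φ
    (fun X => levelPotential_nonneg h₂0 h₃0 hH₂ hH₃ _ (extremeMass_nonneg G _ _ _)) ?_ x
  · refine hbound.trans (ENNReal.ofReal_le_ofReal ?_)
    exact levelPotential_le hH₂ hH₃
      (h₂1 _ (extremeMass_nonneg G _ _ _) (extremeMass_le_one G hdeg _ _ _))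
      (h₃1 _ (extremeMass_nonneg G _ _ _) (extremeMass_le_one G hdeg _ _ _)) hk hx
  intro X hX
  set s := lowest X with hs
  set l := highest X with hl
  have hsl : s + 2 ≤ l := lowest_add_two_le_highest hX
  -- The values `s` and `l` are frozen during the step. If an extreme disappears, the frozen mean is
  -- zero, but the frozen potential still dominates the true one.
  have hle : stepMean G Φ X ≤
      stepMean G (fun Y => levelPotential h₂ h₃ H₂ H₃ (l - s) (extremeMass G Y s l)) X := by
    refine stepMean_mono G fun v w => ?_
    have h1 := lowest_le_update X (v, w)
    have h2 := highest_update_le X (v, w)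
    rcases (show highest (update X (v, w)) - lowest (update X (v, w)) ≤ l - s by omega).eq_or_lt
      with h | h
    · have e1 : lowest (update X (v, w)) = s := by omega
      have e2 : highest (update X (v, w)) = l := by omega
      simp only [hΦ, e1, e2, le_refl]
    · exact levelPotential_le_of_lt h₂0 h₃0 hH₂ hH₃ h
        (h₂1 _ (extremeMass_nonneg G _ _ _) (extremeMass_le_one G hdeg _ _ _))
        (h₃1 _ (extremeMass_nonneg G _ _ _) (extremeMass_le_one G hdeg _ _ _))
        (extremeMass_nonneg G _ _ _)
  obtain ⟨ρ, hρ, hρ1, hρ3, hρ2⟩ := exists_stepMean_extremeMass_le G hdeg hlam hp0.le hp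
    (lowest_le X) (le_highest X) (levelSet_lowest_nonempty X) (levelSet_highest_nonempty X) hsl
  have hρ0 : 0 ≤ ρ := le_trans (by positivity) hρ1
  have hβρ : 1 ≤ β * ρ := by
    calc (1 : ℝ) = β * (p / (16 * n)) := by rw [hβdef]; field_simp
      _ ≤ β * ρ := by gcongr
  suffices h : stepMean G Φ X ≤ Φ X - 1 by
    unfold stepMean at h
    linarith
  have hΦX : Φ X = levelPotential h₂ h₃ H₂ H₃ (l - s) (extremeMass G X s l) := rfl
  refine hle.trans ?_
  rw [hΦX]
  by_cases hr : l = s + 2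
  · have e : ∀ z, levelPotential h₂ h₃ H₂ H₃ (l - s) z = h₂ z := by
      intro z
      rw [levelPotential, if_neg (by omega), if_pos (by omega)]
    simp only [e]
    refine stepMean_barrier_le G hdeg hα₂ hβ hζ₂ (fun Y => extremeMass_nonneg G Y s l) hρ hρ0
      (fun _ => hβρ) fun hz => ?_
    have h := hρ2 hr (hlζ₂.trans hz.le)
    set z := extremeMass G X s l
    calc 2 * z = 4 * n / ζ₂ * (ζ₂ * z / (2 * n)) := by field_simp; ring
      _ ≤ 4 * n / ζ₂ * (z ^ 2 / (2 * n)) := by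
        have : 0 ≤ z := extremeMass_nonneg G _ _ _
        rw [sq]
        gcongr
      _ ≤ _ := by gcongr
  · have e : ∀ z, levelPotential h₂ h₃ H₂ H₃ (l - s) z
        = (H₂ + ((l - s : ℤ) - 3) * H₃) + 1 * h₃ z := by
      intro z
      rw [levelPotential, if_neg (by omega), if_neg (by omega)]
      ring
    simp only [e]
    rw [stepMean_affine G hdeg]
    have := stepMean_barrier_le G hdeg hα₃ hβ hζ₃ (fun Y => extremeMass_nonneg G Y s l) hρ hρ0
      (fun _ => hβρ) fun hz => by
        have h := hρ3 hr (hlζ₃.trans hz.le)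
        calc 2 * extremeMass G X s l = 16 * n * (extremeMass G X s l / (8 * n)) := by
              field_simp; ring
          _ ≤ _ := by gcongr
    linarith

/-! ### Asymptotics of the bound. -/

/-- The order of magnitude of the expected reduction time, for `n` vertices, `k` opinions and
second eigenvalue `l`. -/
noncomputable def timeScale (n k l : ℝ) : ℝ :=
  k * n * Real.log n + n ^ (5 / 3 : ℝ) * Real.log n + l * k * n ^ 2 + √l * n ^ 2

/-- The summand `1/√n` in the first threshold balances `n/ζ` against `n²ζ`, up to a logarithm; the
summand `1/n` in the second keeps `n²ζ` of order `n + λn²`. -/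
theorem explicit_bound_le_timeScale {n k l c : ℝ} (hn : 3 ≤ n) (hk : 1 ≤ k) (hl : 0 ≤ l)
    (hc : 0 < c) :
    (4 * n / (2 * l + 1 / √n) * Real.log (1 + 1 / (2 * l + 1 / √n))
        + 16 * n / (1 / (c * n)) * (2 * l + 1 / √n)) +
      k * (16 * n * Real.log (1 + 1 / (4 * l + 1 / n))
        + 16 * n / (1 / (c * n)) * (4 * l + 1 / n))
      ≤ (32 + 96 * c) * timeScale n k l := by
  have hn0 : 0 < n := by linarith
  set q := √n with hq
  have hq0 : 0 < q := Real.sqrt_pos.2 hn0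
  have hqq : q * q = n := Real.mul_self_sqrt hn0.le
  have hq1 : 1 ≤ q := Real.one_le_sqrt.2 (by linarith)
  have hqn : q ≤ n := by nlinarith
  set L := Real.log n with hL
  have hL1 : 1 ≤ L := by
    rw [hL, Real.le_log_iff_exp_le hn0]
    exact (Real.exp_one_lt_d9.le.trans (by norm_num)).trans hn
  have hlog : Real.log (1 + n) ≤ 2 * L := by
    rw [hL, ← Real.log_rpow hn0]
    refine Real.log_le_log (by positivity) ?_
    norm_num
    nlinarith
  have hinv : ∀ m : ℝ, 0 < m → ∀ d : ℝ, 0 ≤ d → 1 / (d + 1 / m) ≤ m := by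
    intro m hm d hd
    rw [div_le_iff₀ (by positivity), mul_add, mul_one_div_cancel hm.ne']
    nlinarith
  have hz2 := hinv q hq0 (2 * l) (by positivity)
  have hz3 := hinv n hn0 (4 * l) (by positivity)
  have hlog2 : Real.log (1 + 1 / (2 * l + 1 / q)) ≤ 2 * L :=
    (Real.log_le_log (by positivity) (by linarith)).trans hlog
  have hlog3 : Real.log (1 + 1 / (4 * l + 1 / n)) ≤ 2 * L :=
    (Real.log_le_log (by positivity) (by linarith)).trans hlog
  -- The argument yields the exponent `3/2`, which is weakened to `5/3`.
  have hpow : n * q ≤ n ^ (5 / 3 : ℝ) := by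
    have : n * q = n ^ (3 / 2 : ℝ) := by
      rw [hq, Real.sqrt_eq_rpow, show (3 / 2 : ℝ) = 1 + 1 / 2 by norm_num, Real.rpow_add hn0,
        Real.rpow_one]
    rw [this]
    exact Real.rpow_le_rpow_of_exponent_le (by linarith) (by norm_num)
  set R := n ^ (5 / 3 : ℝ) with hR
  have hR0 : 0 < R := by positivity
  have hlog20 : 0 ≤ Real.log (1 + 1 / (2 * l + 1 / q)) :=
    Real.log_nonneg (by have : 0 ≤ 1 / (2 * l + 1 / q) := by positivity
                        linarith)
  have t1 : 4 * n / (2 * l + 1 / q) * Real.log (1 + 1 / (2 * l + 1 / q)) ≤ 8 * (R * L) := by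
    calc _ = 4 * n * (1 / (2 * l + 1 / q)) * Real.log (1 + 1 / (2 * l + 1 / q)) := by
          rw [mul_one_div]
      _ ≤ 4 * n * q * (2 * L) := by gcongr
      _ = 8 * (n * q * L) := by ring
      _ ≤ _ := by gcongr
  have t2 : 16 * n / (1 / (c * n)) * (2 * l + 1 / q)
      ≤ 32 * c * (l * k * n ^ 2) + 16 * c * (R * L) := by
    have e : 16 * n / (1 / (c * n)) * (2 * l + 1 / q)
        = 32 * c * (l * 1 * n ^ 2) + 16 * c * (n * q * 1) := by
      rw [← hqq]
      field_simp
      ring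
    rw [e]
    gcongr
  have t3 : k * (16 * n * Real.log (1 + 1 / (4 * l + 1 / n))) ≤ 32 * (k * n * L) := by
    calc _ ≤ k * (16 * n * (2 * L)) := by gcongr
      _ = _ := by ring
  have t4 : k * (16 * n / (1 / (c * n)) * (4 * l + 1 / n))
      ≤ 64 * c * (l * k * n ^ 2) + 16 * c * (k * n * L) := by
    have e : k * (16 * n / (1 / (c * n)) * (4 * l + 1 / n))
        = 64 * c * (l * k * n ^ 2) + 16 * c * (k * n * 1) := by
      field_simp
      ring
    rw [e]
    gcongr
  have p1 : 0 ≤ k * n * L := by positivity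
  have p2 : 0 ≤ R * L := by positivity
  have p3 : 0 ≤ l * k * n ^ 2 := by positivity
  -- The term `√λ n²` is pure slack: the other three already bound the left side.
  have p4 : 0 ≤ √l * n ^ 2 := by positivity
  have c1 := mul_nonneg hc.le p1
  have c2 := mul_nonneg hc.le p2
  have c3 := mul_nonneg hc.le p3
  have c4 := mul_nonneg hc.le p4
  unfold timeScale
  rw [mul_add k]
  nlinarith

/-- The expected reduction time on a connected graph with `π_min ≥ 1/(cn)` and second eigenvalue
at most `1/2`. -/
theorem lintegral_reductionTime_le_timeScale {n : ℕ} [NeZero n] (hn : 3 ≤ n)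
    (G : SimpleGraph (Fin n)) [DecidableRel G.Adj] (hG : G.Connected)
    (hlam : secondEigenvalue G ≤ 1 / 2) {c : ℝ} (hc : 0 < c)
    (hmin : 1 / (c * n) ≤ stationaryMin G) {k : ℕ} (hk : 1 ≤ k) {x : Fin n → ℤ}
    (hx : ∀ v, x v ∈ Set.Icc (1 : ℤ) k) :
    ∫⁻ ω, (reductionTime x ω : ENNReal) ∂(choicesLaw G)
      ≤ ENNReal.ofReal ((32 + 96 * c) * timeScale n k (secondEigenvalue G)) := by
  have hnt : Nontrivial (Fin n) := Fin.nontrivial_iff_two_le.2 (by omega)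
  have hdeg : ∀ v, 0 < G.degree v := fun v => hG.preconnected.degree_pos_of_nontrivial v
  have hn0 : (0 : ℝ) < n := by exact_mod_cast (show 0 < n by omega)
  have hl := secondEigenvalue_nonneg (G := G)
  have hp : ∀ v, 1 / (c * n) ≤ stationary G v := fun v =>
    hmin.trans (ciInf_le (Set.finite_range _).bddBelow v)
  have hr : ((highest x - lowest x : ℤ) : ℝ) ≤ (k : ℝ) := by
    have h1 : highest x ≤ k := Finset.sup'_le _ _ fun v _ => (hx v).2
    have h2 : 1 ≤ lowest x := Finset.le_inf' _ _ fun v _ => (hx v).1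
    exact_mod_cast (show highest x - lowest x ≤ (k : ℤ) by omega)
  have hsq : 0 < √(n : ℝ) := Real.sqrt_pos.2 hn0
  have h := lintegral_reductionTime_le_explicit G hdeg hlam (p := 1 / (c * n)) (by positivity) hp
    (ζ₂ := 2 * secondEigenvalue G + 1 / √(n : ℝ)) (ζ₃ := 4 * secondEigenvalue G + 1 / (n : ℝ))
    (by positivity) (by positivity) (le_add_of_nonneg_right (by positivity))
    (le_add_of_nonneg_right (by positivity)) x (k := (k : ℝ)) (by positivity) hr
  rw [Fintype.card_fin] at h
  exact h.trans (ENNReal.ofReal_le_ofReal (explicit_bound_le_timeScale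
    (by exact_mod_cast hn) (by exact_mod_cast hk) hl hc))

/-- Markov's inequality for the reduction time. -/
theorem one_sub_le_measureReal_reductionTime_le {V : Type*} [Fintype V] [DecidableEq V]
    [Nonempty V] [MeasurableSpace V] [DiscreteMeasurableSpace V] (G : SimpleGraph V)
    [DecidableRel G.Adj] {x : V → ℤ} {B ε : ℝ} (hB : 0 ≤ B)
    (h : ∫⁻ ω, (reductionTime x ω : ENNReal) ∂(choicesLaw G) ≤ ENNReal.ofReal B) {T : ℕ}
    (hT : 0 < T) (hBT : B ≤ ε * T) :
    1 - ε ≤ (choicesLaw G).real {ω | reductionTime x ω ≤ (T : ℕ∞)} := by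
  have hTr : (0 : ℝ) < T := by exact_mod_cast hT
  have hmeas : MeasurableSet {ω : ℕ → V × V | reductionTime x ω ≤ (T : ℕ∞)} := by
    have : {ω : ℕ → V × V | reductionTime x ω ≤ (T : ℕ∞)}
        = {ω | (reductionTime x ω : ENNReal) ≤ (T : ENNReal)} := by
      ext ω
      simp only [Set.mem_ofPred_eq]
      rw [← ENat.toENNReal_coe, ENat.toENNReal_le]
    rw [this]
    exact measurableSet_le (measurable_reductionTime x) measurable_const
  have hmarkov := (mul_meas_ge_le_lintegral₀ (measurable_reductionTime x).aemeasurable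
    (T : ENNReal) (μ := choicesLaw G)).trans h
  -- Markov bounds the larger event `τ ≥ T`, which contains `τ > T`.
  have hsub : {ω : ℕ → V × V | reductionTime x ω ≤ (T : ℕ∞)}ᶜ
      ⊆ {ω | (T : ENNReal) ≤ (reductionTime x ω : ENNReal)} := by
    intro ω hω
    simp only [Set.mem_compl_iff, Set.mem_ofPred_eq, not_le] at hω ⊢
    rw [← ENat.toENNReal_coe, ENat.toENNReal_le]
    exact hω.le
  have hreal : (T : ℝ) * (choicesLaw G).real {ω | (T : ENNReal) ≤ (reductionTime x ω : ENNReal)}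
      ≤ B := by
    have := ENNReal.toReal_mono ENNReal.ofReal_ne_top hmarkov
    rwa [ENNReal.toReal_mul, ENNReal.toReal_natCast, ENNReal.toReal_ofReal hB] at this
  have hcompl := measureReal_compl (μ := choicesLaw G) hmeas
  rw [probReal_univ] at hcompl
  have hle := measureReal_mono (μ := choicesLaw G) hsub
  have : (choicesLaw G).real {ω | (T : ENNReal) ≤ (reductionTime x ω : ENNReal)} ≤ ε := by
    refine le_of_mul_le_mul_left ?_ hTr
    linarith
  linarith

/-- The terms are handled by `k = o(n/log n)`, by `log n = o(n^(1/3))`, by `λk = o(1)`, and by `λ ≤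
λk → 0`. -/
theorem timeScale_isLittleO {n k : ℕ → ℕ} {l : ℕ → ℝ} (hn : Tendsto n atTop atTop)
    (hk : ∀ j, 1 ≤ k j) (hl : ∀ j, 0 ≤ l j)
    (hlk : (fun j => l j * (k j : ℝ)) =o[atTop] fun _ => (1 : ℝ))
    (hkn : (fun j => (k j : ℝ)) =o[atTop] fun j => (n j : ℝ) / Real.log (n j)) :
    (fun j => timeScale (n j) (k j) (l j)) =o[atTop] fun j => (n j : ℝ) ^ 2 := by
  have hnr : Tendsto (fun j => (n j : ℝ)) atTop atTop := tendsto_natCast_atTop_atTop.comp hn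
  have hlt : Tendsto l atTop (nhds 0) := by
    refine squeeze_zero hl (fun j => ?_) ((isLittleO_one_iff ℝ).1 hlk)
    exact le_mul_of_one_le_right (hl j) (by exact_mod_cast hk j)
  have hsq : (fun j => √(l j)) =o[atTop] fun _ => (1 : ℝ) := by
    rw [isLittleO_one_iff]
    simpa [Function.comp_def] using (Real.continuous_sqrt.tendsto 0).comp hlt
  have hlarge : ∀ᶠ j in atTop, 1 < (n j : ℝ) := hnr.eventually_gt_atTop 1
  refine ((IsLittleO.add ?_ ?_).add ?_).add ?_
  · have h := hkn.mul_isBigO (isBigO_refl (fun j => (n j : ℝ) * Real.log (n j)) atTop)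
    refine (h.congr_left fun j => by ring).congr' EventuallyEq.rfl ?_
    filter_upwards [hlarge] with j hj
    have := Real.log_pos hj
    field_simp
  · have h0 := (isLittleO_log_rpow_atTop (show (0 : ℝ) < 1 / 3 by norm_num)).comp_tendsto hnr
    have h := (isBigO_refl (fun j => (n j : ℝ) ^ (5 / 3 : ℝ)) atTop).mul_isLittleO h0
    refine h.congr' EventuallyEq.rfl ?_
    filter_upwards [hlarge] with j hj
    simp only [Function.comp_apply]
    rw [← Real.rpow_add (by linarith), ← Real.rpow_natCast]
    norm_num
  · simpa using hlk.mul_isBigO (isBigO_refl (fun j => (n j : ℝ) ^ 2) atTop)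
  · simpa using hsq.mul_isBigO (isBigO_refl (fun j => (n j : ℝ) ^ 2) atTop)

end IncrementalVoting

/-! ### The theorem. -/

open IncrementalVoting in
theorem theorem1 (n : ℕ → ℕ) [∀ j, NeZero (n j)] (hn : Tendsto n atTop atTop)
    (G : ∀ j, SimpleGraph (Fin (n j))) [∀ j, DecidableRel (G j).Adj]
    (hG : ∀ j, (G j).Connected)
    (k : ℕ → ℕ) (hk : ∀ j, 1 ≤ k j)
    (hlk : (fun j => secondEigenvalue (G j) * (k j : ℝ)) =o[atTop] fun _ => (1 : ℝ))
    (hkn : (fun j => (k j : ℝ)) =o[atTop] fun j => (n j : ℝ) / Real.log (n j))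
    (hpi : (fun j => stationaryMin (G j)) =Θ[atTop] fun j => 1 / (n j : ℝ)) :
    (∃ T : ℕ → ℕ, ((fun j => (T j : ℝ)) =o[atTop] fun j => (n j : ℝ) ^ 2) ∧
      ∀ ε : ℝ, 0 < ε → ∀ᶠ j in atTop, ∀ x : Fin (n j) → ℤ,
        (∀ v, x v ∈ Set.Icc (1 : ℤ) (k j)) →
          1 - ε ≤ (choicesLaw (G j)).real {ω | reductionTime x ω ≤ (T j : ℕ∞)}) ∧
    (∃ C : ℝ, ∀ᶠ j in atTop, ∀ x : Fin (n j) → ℤ,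
        (∀ v, x v ∈ Set.Icc (1 : ℤ) (k j)) →
          ∫⁻ ω, (reductionTime x ω : ENNReal) ∂(choicesLaw (G j)) ≤
            ENNReal.ofReal (C *
              ((k j : ℝ) * n j * Real.log (n j)
                + (n j : ℝ) ^ (5 / 3 : ℝ) * Real.log (n j)
                + secondEigenvalue (G j) * k j * (n j : ℝ) ^ 2
                + Real.sqrt (secondEigenvalue (G j)) * (n j : ℝ) ^ 2))) := by
  have hl : ∀ j, 0 ≤ secondEigenvalue (G j) := fun j => secondEigenvalue_nonneg
  obtain ⟨c, hc, hcb⟩ := hpi.2.exists_pos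
  set C : ℝ := 32 + 96 * c with hC
  have hC0 : 0 < C := by positivity
  set f : ℕ → ℝ := fun j => timeScale (n j) (k j) (secondEigenvalue (G j)) with hf
  have hn3 : ∀ᶠ j in atTop, 3 ≤ n j := hn.eventually_ge_atTop 3
  have hmean : ∀ᶠ j in atTop, ∀ x : Fin (n j) → ℤ, (∀ v, x v ∈ Set.Icc (1 : ℤ) (k j)) →
      ∫⁻ ω, (reductionTime x ω : ENNReal) ∂(choicesLaw (G j)) ≤ ENNReal.ofReal (C * f j) := by
    filter_upwards [hn3, hcb.bound, hlk.bound (show (0 : ℝ) < 1 / 2 by norm_num)]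
      with j hj hcj hlj x hx
    have hnj : (0 : ℝ) < n j := by exact_mod_cast (show 0 < n j by omega)
    refine lintegral_reductionTime_le_timeScale hj (G j) (hG j) ?_ hc ?_ (hk j) hx
    · have h1 : (1 : ℝ) ≤ k j := by exact_mod_cast hk j
      rw [Real.norm_of_nonneg (mul_nonneg (hl j) (by positivity)), norm_one, mul_one] at hlj
      exact (le_mul_of_one_le_right (hl j) h1).trans hlj
    · have h0 : 0 ≤ stationaryMin (G j) := Real.iInf_nonneg fun v => stationary_nonneg _ v
      rw [Real.norm_of_nonneg (by positivity), Real.norm_of_nonneg h0] at hcj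
      rw [mul_comm, ← div_div, div_le_iff₀ hc]
      linarith
  have hfo : f =o[atTop] fun j => (n j : ℝ) ^ 2 := timeScale_isLittleO hn hk hl hlk hkn
  have hnr : Tendsto (fun j => (n j : ℝ)) atTop atTop := tendsto_natCast_atTop_atTop.comp hn
  have hfpos : ∀ᶠ j in atTop, 0 < f j := by
    filter_upwards [hn3] with j hj
    have h3 : (3 : ℝ) ≤ n j := by exact_mod_cast hj
    have h1 : (1 : ℝ) ≤ k j := by exact_mod_cast hk j
    have hL : 0 < Real.log (n j) := Real.log_pos (by linarith)
    have := hl j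
    simp only [hf, timeScale]
    positivity
  have hsqrt : ∀ δ : ℝ, 0 < δ → ∀ᶠ j in atTop, √(f j) ≤ δ * n j := by
    intro δ hδ
    filter_upwards [hfo.bound (show 0 < δ ^ 2 by positivity), hfpos] with j hj hpos
    rw [Real.norm_of_nonneg hpos.le, Real.norm_of_nonneg (by positivity), ← mul_pow] at hj
    exact Real.sqrt_le_iff.2 ⟨by positivity, hj⟩
  -- `n√f` is the geometric mean of `f` and `n²`. As `f = o(n²)`, it is `o(n²)` while `f = o(n√f)`,
  -- which is what Markov's inequality needs.
  refine ⟨⟨fun j => ⌈(n j : ℝ) * √(f j)⌉₊, ?_, fun ε hε => ?_⟩, C, hmean⟩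
  · refine isLittleO_iff.2 fun δ hδ => ?_
    filter_upwards [hsqrt (δ / 2) (by positivity), hn3,
      hnr.eventually_ge_atTop (2 / δ)] with j hj h3 hlarge
    have h3 : (3 : ℝ) ≤ n j := by exact_mod_cast h3
    have hceil := (Nat.ceil_lt_add_one (show 0 ≤ (n j : ℝ) * √(f j) by positivity)).le
    rw [Real.norm_of_nonneg (by positivity), Real.norm_of_nonneg (by positivity)]
    have h1 : 1 ≤ δ / 2 * (n j : ℝ) ^ 2 := by
      rw [div_le_iff₀ hδ] at hlarge
      nlinarith
    have h2 : (n j : ℝ) * √(f j) ≤ n j * (δ / 2 * n j) := by gcongr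
    nlinarith
  · filter_upwards [hmean, hsqrt (ε / C) (by positivity), hfpos, hn3] with j hj hsq hpos h3 x hx
    have hnj : (0 : ℝ) < n j := by exact_mod_cast (show 0 < n j by omega)
    have hs := Real.sqrt_pos.2 hpos
    refine one_sub_le_measureReal_reductionTime_le (G j) (by positivity) (hj x hx)
      (Nat.ceil_pos.2 (by positivity)) ?_
    calc C * f j = C * (√(f j) * √(f j)) := by rw [Real.mul_self_sqrt hpos.le]
      _ ≤ C * (ε / C * n j * √(f j)) := by gcongr
      _ = ε * (n j * √(f j)) := by field_simp
      _ ≤ _ := by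
        gcongr
        exact Nat.le_ceil _
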